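/- Let $n\in\mathbb N\cup\{\omega\}$. An $n$-globular set is a family of sets $X_k$ ($k\le n$, and $k<\omega$) with source and target maps $\partial^-_k,\partial^+_k\colon X_{k+1}\to X_k$ such that $\partial^\epsilon_k\partial^-_{k+1}=\partial^\epsilon_k\partial^+_{k+1}$ for $\epsilon\in\{-,+\}$; write $\partial^\epsilon_i\colon X_k\to X_i$ ($i\le k$) for the iterated maps. An $n$-precategory is an $n$-globular set $C$ with identities $\mathrm{id}\colon C_k\to C_{k+1}$ and compositions $u\star_i v\in C_{\max(k,l)}$ for $u\in C_k$, $v\in C_l$ with $i=\min(k,l)-1\ge 0$ and $\partial^+_i u=\partial^-_i v$, such that (whenever the composites below are defined): (1) $\partial^\pm_k\,\mathrm{id}(u)=u$ for $u\in C_k$; (2) if $m=\max(k,l)$, then $\partial^\epsilon_{m-1}(u\star_i v)$ is $u\star_i\partial^\epsilon_{m-1} v$ if $k<l$, is $\partial^\epsilon_{m-1} u\star_i v$ if $k>l$, and is $\partial^-_i u$ (for $\epsilon=-$) or $\partial^+_i v$ (for $\epsilon=+$) if $k=l$; (3) if $\mathrm{id}(u)\in C_k$ and $v\in C_l$, then $\mathrm{id}(u)\star_i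 v$ is $v$ if $k\le l$ and $\mathrm{id}(u\star_i v)$ if $k>l$, and symmetrically on the right; (4) $(u\star_i v)\star_i w=u\star_i(v\star_i w)$; (5) for $i<j$, $u\star_i(v\star_j v')=(u\star_i v)\star_j(u\star_i v')$ and $(u\star_j u')\star_i v=(u\star_i v)\star_j(u'\star_i v)$. Prefunctors are the maps of $n$-globular sets that preserve identities and compositions; they are the morphisms of the category $\mathbf{PCat}_n$. The category $\mathbf{Pol}_n$ of $n$-polygraphs and the free functor $(-)^*\colon\mathbf{Pol}_n\to\mathbf{PCat}_n$ are defined by induction on $n\in\mathbb N$. A $0$-polygraph is a set $P_0$, and $P^*=P_0$. An $(n+1)$-polygraph is an $n$-polygraph $P$ together with a set $P_{n+1}$ of $(n+1)$-generators, each having a source and a target which are parallel $n$-cells of $P^*$; a morphism is a morphism $F$ of $n$-polygraphs with a map $F_{n+1}$ between the sets of $(n+1)$-generators that is compatible with sources and targets via $F^*$; the associated $(n+1)$-precategory is the one obtained from $P^*$ by freely adjoining the $(n+1)$-generators. The category $\mathbf{Pol}_\omega$ is the limit of the categories $\mathbf{Pol}_n$ along truncation, and for an $\omega$-polygraph $P$,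 the $n$-truncation of the $\omega$-precategory $P^*$ is the free $n$-precategory on the $n$-truncation of $P$. **Proposition.** Let $n\in\mathbb N\cup\{\omega\}$ and let $F\colon P\to Q$ be a morphism of $n$-polygraphs. The following are equivalent: (i) $F$ is a monomorphism in $\mathbf{Pol}_n$; (ii) for every $k\le n$ (for every $k\in\mathbb N$ if $n=\omega$), the map $F_k\colon P_k\to Q_k$ between the sets of $k$-generators is injective; (iii) the prefunctor $F^*\colon P^*\to Q^*$ is a monomorphism in $\mathbf{PCat}_n$. -/

import Mathlib

universe u

open CategoryTheory

/-- The set of dimensions `k ≤ n`, for `n ∈ ℕ ∪ {ω}` (with `ω = ⊤`). -/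
abbrev Dim (n : ℕ∞) : Type := {k : ℕ // (k : ℕ∞) ≤ n}

/-- An `n`-globular set, as a presheaf on the globe category: `bd false i` and `bd true i` are the
(iterated) source and target operations `∂⁻_i, ∂⁺_i : X_k → X_i` for `i ≤ k` (the identity when
`i = k`), and `bd_bd` says that they are composed of one-step sources and targets which satisfy
the globular identities. -/
structure GlobularSet (n : ℕ∞) where
  cell : Dim n → Type u
  bd : Bool → ∀ (i : Dim n) {k : Dim n}, cell k → i.1 ≤ k.1 → cell i
  bd_self : ∀ (ε : Bool) {k : Dim n} (x : cell k), bd ε k x le_rfl = x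
  bd_bd : ∀ (ε η : Bool) {i j k : Dim n} (hij : i.1 < j.1) (hjk : j.1 ≤ k.1) (x : cell k),
    bd ε i (bd η j x hjk) hij.le = bd ε i x (hij.le.trans hjk)

/-- Morphisms of globular sets. -/
@[ext]
structure GlobularSet.Hom {n : ℕ∞} (X Y : GlobularSet.{u} n) where
  map : ∀ k : Dim n, X.cell k → Y.cell k
  map_bd : ∀ (ε : Bool) {i k : Dim n} (h : i.1 ≤ k.1) (x : X.cell k),
    map i (X.bd ε i x h) = Y.bd ε i (map k x) h

/-- The composite `u ⋆_i v` of a `k`-cell `u` and an `l`-cell `v` is defined, and is an `m`-cell. -/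
structure GlobularSet.Composable {n : ℕ∞} (X : GlobularSet.{u} n) (i m : Dim n) {k l : Dim n}
    (u : X.cell k) (v : X.cell l) : Prop where
  hi : i.1 + 1 = min k.1 l.1
  hm : m.1 = max k.1 l.1
  eq : X.bd true i u (by omega) = X.bd false i v (by omega)

/-- An `n`-precategory. In each axiom, every composite that occurs comes with the assumption that it
is defined; for example, in `distrib_left`, `h₁` and `h₂` say that `v ⋆_j v'` and
`u ⋆_i (v ⋆_j v')` are defined. -/
structure Precat (n : ℕ∞) extends GlobularSet.{u} n where
  /-- identities -/
  idn : ∀ {k k' : Dim n}, k.1 + 1 = k'.1 → cell k → cell k'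
  /-- compositions: `comp i m u v h` is `u ⋆_i v` -/
  comp : ∀ (i m : Dim n) {k l : Dim n} (u : cell k) (v : cell l),
    toGlobularSet.Composable i m u v → cell m
  -- source and target of identities
  bd_idn : ∀ (ε : Bool) {k k' : Dim n} (h : k.1 + 1 = k'.1) (u : cell k),
    bd ε k (idn h u) (by omega) = u
  -- source and target of composites
  bd_comp_lt : ∀ (ε : Bool) {i j k l : Dim n} (_ : k.1 < l.1) (hj : j.1 + 1 = l.1)
    (u : cell k) (v : cell l) (h : toGlobularSet.Composable i l u v)
    (h' : toGlobularSet.Composable i j u (bd ε j v (by omega))),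
    bd ε j (comp i l u v h) (by omega) = comp i j u (bd ε j v (by omega)) h'
  bd_comp_gt : ∀ (ε : Bool) {i j k l : Dim n} (_ : l.1 < k.1) (hj : j.1 + 1 = k.1)
    (u : cell k) (v : cell l) (h : toGlobularSet.Composable i k u v)
    (h' : toGlobularSet.Composable i j (bd ε j u (by omega)) v),
    bd ε j (comp i k u v h) (by omega) = comp i j (bd ε j u (by omega)) v h'
  src_comp : ∀ {i k : Dim n} (hi : i.1 + 1 = k.1) (u v : cell k)
    (h : toGlobularSet.Composable i k u v),
    bd false i (comp i k u v h) (by omega) = bd false i u (by omega)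
  tgt_comp : ∀ {i k : Dim n} (hi : i.1 + 1 = k.1) (u v : cell k)
    (h : toGlobularSet.Composable i k u v),
    bd true i (comp i k u v h) (by omega) = bd true i v (by omega)
  -- composition with identities
  idn_comp : ∀ {i k k' l : Dim n} (hk : k.1 + 1 = k'.1) (_ : k'.1 ≤ l.1) (u : cell k) (v : cell l)
    (h : toGlobularSet.Composable i l (idn hk u) v), comp i l (idn hk u) v h = v
  idn_comp' : ∀ {i k k' l : Dim n} (hk : k.1 + 1 = k'.1) (_ : l.1 < k'.1) (u : cell k) (v : cell l)
    (h : toGlobularSet.Composable i k' (idn hk u) v) (h' : toGlobularSet.Composable i k u v),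
    comp i k' (idn hk u) v h = idn hk (comp i k u v h')
  comp_idn : ∀ {i k l l' : Dim n} (hl : l.1 + 1 = l'.1) (_ : l'.1 ≤ k.1) (u : cell k) (v : cell l)
    (h : toGlobularSet.Composable i k u (idn hl v)), comp i k u (idn hl v) h = u
  comp_idn' : ∀ {i k l l' : Dim n} (hl : l.1 + 1 = l'.1) (_ : k.1 < l'.1) (u : cell k) (v : cell l)
    (h : toGlobularSet.Composable i l' u (idn hl v)) (h' : toGlobularSet.Composable i l u v),
    comp i l' u (idn hl v) h = idn hl (comp i l u v h')
  -- associativity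
  assoc : ∀ {i k l m p q r : Dim n} (u : cell k) (v : cell l) (w : cell m)
    (h₁ : toGlobularSet.Composable i p u v)
    (h₂ : toGlobularSet.Composable i r (comp i p u v h₁) w)
    (h₃ : toGlobularSet.Composable i q v w)
    (h₄ : toGlobularSet.Composable i r u (comp i q v w h₃)),
    comp i r (comp i p u v h₁) w h₂ = comp i r u (comp i q v w h₃) h₄
  -- distributivity of `⋆_i` over `⋆_j` for `i < j`
  distrib_left : ∀ {i j k l l' m : Dim n} (_ : i.1 < j.1) (u : cell k) (v : cell l) (v' : cell l')
    (h₁ : toGlobularSet.Composable j m v v')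
    (h₂ : toGlobularSet.Composable i m u (comp j m v v' h₁))
    (h₃ : toGlobularSet.Composable i l u v)
    (h₄ : toGlobularSet.Composable i l' u v')
    (h₅ : toGlobularSet.Composable j m (comp i l u v h₃) (comp i l' u v' h₄)),
    comp i m u (comp j m v v' h₁) h₂ = comp j m (comp i l u v h₃) (comp i l' u v' h₄) h₅
  distrib_right : ∀ {i j k l l' m : Dim n} (_ : i.1 < j.1) (u : cell l) (u' : cell l') (v : cell k)
    (h₁ : toGlobularSet.Composable j m u u')
    (h₂ : toGlobularSet.Composable i m (comp j m u u' h₁) v)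
    (h₃ : toGlobularSet.Composable i l u v)
    (h₄ : toGlobularSet.Composable i l' u' v)
    (h₅ : toGlobularSet.Composable j m (comp i l u v h₃) (comp i l' u' v h₄)),
    comp i m (comp j m u u' h₁) v h₂ = comp j m (comp i l u v h₃) (comp i l' u' v h₄) h₅

theorem GlobularSet.Hom.composable {n : ℕ∞} {X Y : GlobularSet.{u} n} (F : X.Hom Y)
    {i m k l : Dim n} {u : X.cell k} {v : X.cell l} (h : X.Composable i m u v) :
    Y.Composable i m (F.map k u) (F.map l v) :=
  ⟨h.hi, h.hm, by rw [← F.map_bd, ← F.map_bd, h.eq]⟩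

namespace Precat

variable {n : ℕ∞}

/-- Prefunctors: the morphisms of `n`-precategories. -/
@[ext]
structure Hom (C D : Precat.{u} n) extends GlobularSet.Hom C.toGlobularSet D.toGlobularSet where
  map_idn : ∀ {k k' : Dim n} (h : k.1 + 1 = k'.1) (x : C.cell k),
    map k' (C.idn h x) = D.idn h (map k x)
  map_comp : ∀ {i m k l : Dim n} (u : C.cell k) (v : C.cell l) (h : C.Composable i m u v),
    map m (C.comp i m u v h) = D.comp i m (map k u) (map l v) (toHom.composable h)

instance : Category (Precat.{u} n) where
  Hom := Hom
  id C := { map := fun _ x => x, map_bd := fun _ _ _ _ _ => rfl, map_idn := fun _ _ => rfl,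
            map_comp := fun _ _ _ => rfl }
  comp F G :=
    { map := fun k x => G.map k (F.map k x)
      map_bd := fun ε _ _ h x => by rw [F.map_bd, G.map_bd]
      map_idn := fun h x => by rw [F.map_idn, G.map_idn]
      map_comp := fun u v h => by rw [F.map_comp u v h, G.map_comp] }

@[ext]
theorem hom_ext {C D : Precat.{u} n} {F G : C ⟶ D} (h : ∀ k x, F.map k x = G.map k x) : F = G :=
  Hom.ext (funext fun k => funext fun x => h k x)

@[simp] theorem id_map (C : Precat.{u} n) (k : Dim n) (x : C.cell k) : (Hom.toHom (𝟙 C)).map k x = x := rfl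

@[simp] theorem comp_map {A B D : Precat.{u} n} (F : A ⟶ B) (G : B ⟶ D) (k : Dim n)
    (x : A.cell k) : (Hom.toHom (F ≫ G)).map k x = G.map k (F.map k x) := rfl

/-- The inclusion of dimensions. -/
abbrev up {m n : ℕ∞} (h : m ≤ n) (k : Dim m) : Dim n := ⟨k.1, k.2.trans h⟩

/-- The truncation of a globular set. -/
def _root_.GlobularSet.trunc {m n : ℕ∞} (h : m ≤ n) (X : GlobularSet.{u} n) :
    GlobularSet.{u} m where
  cell k := X.cell (up h k)
  bd ε i {k} x hik := X.bd ε (up h i) (k := up h k) x hik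
  bd_self ε _ x := X.bd_self ε x
  bd_bd ε η {i j k} hij hjk x :=
    X.bd_bd ε η (i := up h i) (j := up h j) (k := up h k) hij hjk x

theorem _root_.GlobularSet.Composable.ofTrunc {m n : ℕ∞} {h : m ≤ n} {X : GlobularSet.{u} n}
    {i p k l : Dim m} {u : X.cell (up h k)} {v : X.cell (up h l)}
    (c : (X.trunc h).Composable i p (k := k) (l := l) u v) :
    X.Composable (up h i) (up h p) u v :=
  ⟨c.hi, c.hm, c.eq⟩

/-- The `m`-truncation of an `n`-precategory, which forgets the cells of dimension `> m`. -/
def trunc {m n : ℕ∞} (h : m ≤ n) : Precat.{u} n ⥤ Precat.{u} m where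
  obj C :=
    { C.toGlobularSet.trunc h with
      idn := fun {k k'} hk x => C.idn (k := up h k) (k' := up h k') hk x
      comp := fun i m {k l} u v c =>
        C.comp (up h i) (up h m) (k := up h k) (l := up h l) u v c.ofTrunc
      bd_idn := fun ε {k k'} hk u => C.bd_idn ε (k := up h k) (k' := up h k') hk u
      bd_comp_lt := fun ε {i j k l} hkl hj u v c c' =>
        C.bd_comp_lt ε (i := up h i) (k := up h k) (l := up h l) (j := up h j)
          hkl hj u v c.ofTrunc c'.ofTrunc
      bd_comp_gt := fun ε {i j k l} hkl hj u v c c' =>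
        C.bd_comp_gt ε (i := up h i) (k := up h k) (l := up h l) (j := up h j)
          hkl hj u v c.ofTrunc c'.ofTrunc
      src_comp := fun {i k} hi u v c =>
        C.src_comp (i := up h i) (k := up h k) hi u v c.ofTrunc
      tgt_comp := fun {i k} hi u v c =>
        C.tgt_comp (i := up h i) (k := up h k) hi u v c.ofTrunc
      idn_comp := fun {i k k' l} hk hl u v c =>
        C.idn_comp (i := up h i) (k := up h k) (k' := up h k') (l := up h l) hk hl u v c.ofTrunc
      idn_comp' := fun {i k k' l} hk hl u v c c' =>
        C.idn_comp' (i := up h i) (k := up h k) (k' := up h k') (l := up h l) hk hl u v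
          c.ofTrunc c'.ofTrunc
      comp_idn := fun {i k l l'} hl hk u v c =>
        C.comp_idn (i := up h i) (k := up h k) (l := up h l) (l' := up h l') hl hk u v c.ofTrunc
      comp_idn' := fun {i k l l'} hl hk u v c c' =>
        C.comp_idn' (i := up h i) (k := up h k) (l := up h l) (l' := up h l') hl hk u v
          c.ofTrunc c'.ofTrunc
      assoc := fun {i k l m p q r} u v w h₁ h₂ h₃ h₄ =>
        C.assoc (i := up h i) (k := up h k) (l := up h l) (m := up h m) (p := up h p)
          (q := up h q) (r := up h r) u v w h₁.ofTrunc h₂.ofTrunc h₃.ofTrunc h₄.ofTrunc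
      distrib_left := fun {i j k l l' m} hij u v v' h₁ h₂ h₃ h₄ h₅ =>
        C.distrib_left (i := up h i) (j := up h j) (k := up h k) (l := up h l) (l' := up h l')
          (m := up h m) hij u v v' h₁.ofTrunc h₂.ofTrunc h₃.ofTrunc h₄.ofTrunc h₅.ofTrunc
      distrib_right := fun {i j k l l' m} hij u u' v h₁ h₂ h₃ h₄ h₅ =>
        C.distrib_right (i := up h i) (j := up h j) (k := up h k) (l := up h l) (l' := up h l')
          (m := up h m) hij u u' v h₁.ofTrunc h₂.ofTrunc h₃.ofTrunc h₄.ofTrunc h₅.ofTrunc }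
  map {C D} F :=
    { map := fun k x => F.map (up h k) x
      map_bd := fun ε {i k} hik x => F.map_bd ε (i := up h i) (k := up h k) hik x
      map_idn := fun {k k'} hk x => F.map_idn (k := up h k) (k' := up h k') hk x
      map_comp := fun {i m k l} u v c =>
        F.map_comp (i := up h i) (k := up h k) (l := up h l) (m := up h m) u v c.ofTrunc }

end Precat

namespace Precat

/-- The top dimension of an `n`-precategory. -/
abbrev top (n : ℕ) : Dim n := ⟨n, le_rfl⟩

theorem Dim.le {n : ℕ} (k : Dim n) : k.1 ≤ n := Nat.cast_le.mp k.2

/-- What has to be added to an `n`-precategory `C` in order to get an `(n+1)`-precategory: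
a set of `(n+1)`-cells, their identities, their compositions `⋆_n`, and their left and right
compositions `⋆_i` with `(i+1)`-cells of `C` for `i < n`, with the axioms of precategories. -/
structure Layer {n : ℕ} (C : Precat.{u} n) where
  T : Type u
  bd : Bool → T → C.cell (top n)
  par : ∀ (ε : Bool) (j : Dim n) (h : j.1 < n) (p : T),
    C.bd ε j (bd false p) h.le = C.bd ε j (bd true p) h.le
  idn : C.cell (top n) → T
  comp : ∀ p q : T, bd true p = bd false q → T
  lw : ∀ {i k : Dim n} (u : C.cell k) (p : T)
    (_ : ∀ ε, C.Composable i (top n) u (bd ε p)), T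
  rw : ∀ {i k : Dim n} (p : T) (u : C.cell k)
    (_ : ∀ ε, C.Composable i (top n) (bd ε p) u), T
  bd_idn : ∀ ε c, bd ε (idn c) = c
  bd_comp : ∀ ε p q h, bd ε (comp p q h) = bif ε then bd true q else bd false p
  bd_lw : ∀ ε {i k : Dim n} (u : C.cell k) p h, bd ε (lw (i := i) u p h) = C.comp i _ u (bd ε p) (h ε)
  bd_rw : ∀ ε {i k : Dim n} (u : C.cell k) p h, bd ε (rw (i := i) p u h) = C.comp i _ (bd ε p) u (h ε)
  idn_comp : ∀ c p h, comp (idn c) p h = p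
  comp_idn : ∀ c p h, comp p (idn c) h = p
  assoc : ∀ p q r h₁ h₂ h₃ h₄, comp (comp p q h₁) r h₂ = comp p (comp q r h₃) h₄
  lw_idn : ∀ {i k : Dim n} (u : C.cell k) (c) (h) (h'),
    lw (i := i) u (idn c) h = idn (C.comp i _ u c h')
  rw_idn : ∀ {i k : Dim n} (u : C.cell k) (c) (h) (h'),
    rw (i := i) (idn c) u h = idn (C.comp i _ c u h')
  idn_lw : ∀ {i k : Dim n} (hi : i.1 + 1 = k.1) (x : C.cell i) (p) (h),
    lw (i := i) (C.idn (k' := k) hi x) p h = p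
  rw_of_idn : ∀ {i k : Dim n} (hi : i.1 + 1 = k.1) (x : C.cell i) (p) (h),
    rw (i := i) p (C.idn (k' := k) hi x) h = p
  lw_lw : ∀ {i k l m : Dim n} (u : C.cell k) (v : C.cell l) (p) (h₁ h₂ h₃ h₄),
    lw (i := i) (C.comp i m u v h₁) p h₂ = lw (i := i) u (lw (i := i) v p h₃) h₄
  lw_rw : ∀ {i k l : Dim n} (u : C.cell k) (v : C.cell l) (p) (h₁ h₂ h₃ h₄),
    rw (i := i) (lw (i := i) u p h₁) v h₂ = lw (i := i) u (rw (i := i) p v h₃) h₄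
  rw_rw : ∀ {i k l m : Dim n} (u : C.cell k) (v : C.cell l) (p) (h₁ h₂ h₃ h₄),
    rw (i := i) (rw (i := i) p u h₁) v h₂ = rw (i := i) p (C.comp i m u v h₃) h₄
  lw_comp : ∀ {i k : Dim n} (u : C.cell k) (p q) (h₁ h₂ h₃ h₄ h₅),
    lw (i := i) u (comp p q h₁) h₂ = comp (lw (i := i) u p h₃) (lw (i := i) u q h₄) h₅
  rw_comp : ∀ {i k : Dim n} (u : C.cell k) (p q) (h₁ h₂ h₃ h₄ h₅),
    rw (i := i) (comp p q h₁) u h₂ = comp (rw (i := i) p u h₃) (rw (i := i) q u h₄) h₅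
  lw_distrib_lw : ∀ {i j k l : Dim n} (_ : i.1 < j.1) (u : C.cell k) (v : C.cell l) (p)
    (h₁ h₂ h₃ h₄ h₅), lw (i := i) u (lw (i := j) v p h₁) h₂
      = lw (i := j) (C.comp i l u v h₃) (lw (i := i) u p h₄) h₅
  lw_distrib_rw : ∀ {i j k l : Dim n} (_ : i.1 < j.1) (u : C.cell k) (v : C.cell l) (p)
    (h₁ h₂ h₃ h₄ h₅), lw (i := i) u (rw (i := j) p v h₁) h₂
      = rw (i := j) (lw (i := i) u p h₄) (C.comp i l u v h₃) h₅
  rw_distrib_lw : ∀ {i j k l : Dim n} (_ : i.1 < j.1) (u : C.cell k) (v : C.cell l) (p)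
    (h₁ h₂ h₃ h₄ h₅), rw (i := i) (lw (i := j) v p h₁) u h₂
      = lw (i := j) (C.comp i l v u h₃) (rw (i := i) p u h₄) h₅
  rw_distrib_rw : ∀ {i j k l : Dim n} (_ : i.1 < j.1) (u : C.cell k) (v : C.cell l) (p)
    (h₁ h₂ h₃ h₄ h₅), rw (i := i) (rw (i := j) p v h₁) u h₂
      = rw (i := j) (rw (i := i) p u h₄) (C.comp i l v u h₃) h₅

/-- The `k`-cells of the `(n+1)`-precategory obtained from an `n`-precategory by adding a layer of
`(n+1)`-cells. -/
inductive ExtCell {n : ℕ} (C : Precat.{u} n) (T : Type u) (k : Dim (n + 1 : ℕ)) : Type u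
  | old (hk : k.1 ≤ n) (c : C.cell ⟨k.1, Nat.cast_le.mpr hk⟩) : ExtCell C T k
  | top (hk : k.1 = n + 1) (t : T) : ExtCell C T k

namespace Layer

variable {n : ℕ} {C : Precat.{u} n} (L : Layer C)

/-- Sources and targets in an extension. -/
def extBd (ε : Bool) (i : Dim (n + 1 : ℕ)) {k : Dim (n + 1 : ℕ)} (hik : i.1 ≤ k.1) :
    ExtCell C L.T k → ExtCell C L.T i
  | .old hk c => .old (hik.trans hk) (C.bd ε _ c hik)
  | .top hk t =>
    if hi : i.1 ≤ n then .old hi (C.bd ε _ (L.bd ε t) hi)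
    else .top (by have := Dim.le i; omega) t

/-- The underlying globular set of an extension. -/
abbrev extGlob : GlobularSet.{u} (n + 1 : ℕ) where
  cell k := ExtCell C L.T k
  bd ε i {k} x hik := L.extBd ε i hik x
  bd_self ε k x := by
    cases x with
    | old hk c => simp [extBd, C.bd_self]
    | top hk t => simp [extBd, hk]
  bd_bd ε η i j k hij hjk x := by
    cases x with
    | old hk c => simp [extBd, C.bd_bd ε η (i := ⟨i.1, _⟩) (j := ⟨j.1, _⟩) (k := ⟨k.1, _⟩) hij hjk]
    | top hk t =>
      have hi : i.1 ≤ n := by have := Dim.le j; omega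
      by_cases hj : j.1 ≤ n
      · simp only [extBd, hi, hj, dite_true]
        rw [C.bd_bd ε η (i := ⟨i.1, _⟩) (j := ⟨j.1, _⟩) (k := top n) hij hj]
        have := L.par ε ⟨i.1, Nat.cast_le.mpr hi⟩ (show i.1 < n by omega) t
        cases ε <;> cases η <;> simp [this]
      · simp [extBd, hi, hj]

variable {L}

theorem extGlob_bd_old {ε : Bool} {i k : Dim (n + 1 : ℕ)} (hik : i.1 ≤ k.1) (hk c) :
    L.extBd ε i (k := k) hik (.old hk c) = .old (hik.trans hk) (C.bd ε _ c hik) := rfl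

theorem extGlob_bd_top {ε : Bool} {i k : Dim (n + 1 : ℕ)} (hik : i.1 ≤ k.1) (hk t) (hi : i.1 ≤ n) :
    L.extBd ε i (k := k) hik (.top hk t) = .old hi (C.bd ε _ (L.bd ε t) hi) := by
  simp [extBd, hi]

theorem extGlob_bd_top' {ε : Bool} {i k : Dim (n + 1 : ℕ)} (hik : i.1 ≤ k.1) (hk t)
    (hi : i.1 = n + 1) :
    L.extBd ε i (k := k) hik (.top hk t) = .top hi t := by
  simp [extBd, hi]

theorem extGlob_bd_top_self {ε : Bool} {k : Dim (n + 1 : ℕ)} {h₀} (hik : n ≤ k.1) (hk t) :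
    L.extBd ε ⟨n, h₀⟩ (k := k) hik (.top hk t) = .old le_rfl (L.bd ε t) := by
  rw [extGlob_bd_top _ _ _ le_rfl, C.bd_self]

theorem comp_old_old {i m k l : Dim (n + 1 : ℕ)} {hk : k.1 ≤ n} {hl : l.1 ≤ n} {u v}
    (h : L.extGlob.Composable i m (k := k) (l := l) (.old hk u) (.old hl v)) :
    C.Composable ⟨i.1, Nat.cast_le.mpr (by have := h.hi; omega)⟩
      ⟨m.1, Nat.cast_le.mpr (by have := h.hm; omega)⟩ u v :=
  ⟨h.hi, h.hm, ExtCell.old.inj h.eq⟩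

theorem comp_old_top {i m k l : Dim (n + 1 : ℕ)} {hk : k.1 ≤ n} {hl : l.1 = n + 1} {u t}
    (h : L.extGlob.Composable i m (k := k) (l := l) (.old hk u) (.top hl t)) (ε : Bool) :
    C.Composable ⟨i.1, Nat.cast_le.mpr (by have := h.hi; omega)⟩ (top n) u (L.bd ε t) := by
  have hi := h.hi
  have hm := h.hm
  have e : L.extBd true i (by omega) (.old hk u) = L.extBd false i (by omega) (.top hl t) := h.eq
  have hin : i.1 < n := by omega
  rw [extGlob_bd_old, extGlob_bd_top _ _ _ hin.le] at e
  refine ⟨by dsimp only; omega, by dsimp only; omega, ?_⟩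
  have e' := (ExtCell.old.inj e)
  rw [e']
  have := L.par false ⟨i.1, Nat.cast_le.mpr hin.le⟩ hin t
  cases ε <;> simp [this]

theorem comp_top_old {i m k l : Dim (n + 1 : ℕ)} {hk : k.1 = n + 1} {hl : l.1 ≤ n} {u t}
    (h : L.extGlob.Composable i m (k := k) (l := l) (.top hk t) (.old hl u)) (ε : Bool) :
    C.Composable ⟨i.1, Nat.cast_le.mpr (by have := h.hi; omega)⟩ (top n) (L.bd ε t) u := by
  have hi := h.hi
  have hm := h.hm
  have e : L.extBd true i (by omega) (.top hk t) = L.extBd false i (by omega) (.old hl u) := h.eq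
  have hin : i.1 < n := by omega
  rw [extGlob_bd_old, extGlob_bd_top _ _ _ hin.le] at e
  refine ⟨by dsimp only; omega, by dsimp only; omega, ?_⟩
  have e' := (ExtCell.old.inj e)
  rw [← e']
  have := L.par true ⟨i.1, Nat.cast_le.mpr hin.le⟩ hin t
  cases ε <;> simp [this]

theorem comp_top_top {i m k l : Dim (n + 1 : ℕ)} {hk : k.1 = n + 1} {hl : l.1 = n + 1} {p q}
    (h : L.extGlob.Composable i m (k := k) (l := l) (.top hk p) (.top hl q)) :
    L.bd true p = L.bd false q := by
  have hi := h.hi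
  have e : L.extBd true i (by omega) (.top hk p) = L.extBd false i (by omega) (.top hl q) := h.eq
  have hin : i.1 = n := by omega
  obtain ⟨i, hi'⟩ := i
  obtain rfl : i = n := hin
  rw [extGlob_bd_top_self, extGlob_bd_top_self] at e
  exact ExtCell.old.inj e

/-- Compositions in an extension. -/
def extComp (i m : Dim (n + 1 : ℕ)) {k l : Dim (n + 1 : ℕ)} :
    ∀ (u : L.extGlob.cell k) (v : L.extGlob.cell l), L.extGlob.Composable i m u v →
      L.extGlob.cell m
  | .old _ u, .old _ v, h => .old (by have := h.hm; omega) (C.comp _ _ u v (comp_old_old h))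
  | .old _ u, .top _ q, h => .top (by have := h.hm; omega) (L.lw u q (comp_old_top h))
  | .top _ p, .old _ v, h => .top (by have := h.hm; omega) (L.rw p v (comp_top_old h))
  | .top _ p, .top _ q, h => .top (by have := h.hm; omega) (L.comp p q (comp_top_top h))

/-- Identities in an extension. -/
def extIdn {k k' : Dim (n + 1 : ℕ)} (h : k.1 + 1 = k'.1) : L.extGlob.cell k → L.extGlob.cell k'
  | .old _ c =>
    if hk' : k'.1 ≤ n then .old hk' (C.idn (k' := ⟨k'.1, Nat.cast_le.mpr hk'⟩) h c)
    else .top (by have := Dim.le k'; omega) (L.idn (C.bd true (top n) c (by dsimp only; omega)))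
  | .top hk _ => (by have := Dim.le k'; omega : False).elim

theorem extIdn_old {k k' : Dim (n + 1 : ℕ)} (h : k.1 + 1 = k'.1) (hk c) (hk' : k'.1 ≤ n) :
    extIdn (L := L) (k := k) h (.old hk c) =
      .old hk' (C.idn (k' := ⟨k'.1, Nat.cast_le.mpr hk'⟩) h c) := by
  simp [extIdn, hk']

theorem extIdn_top {h₀ h₁} {hk} (c : C.cell (top n)) :
    extIdn (L := L) (k := ⟨n, h₀⟩) (k' := ⟨n + 1, h₁⟩) rfl (.old hk c) =
      .top rfl (L.idn c) := by
  have := C.bd_self true c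
  simp [extIdn, this]

variable (L) in
/-- The `(n+1)`-precategory obtained from an `n`-precategory by adding a layer of `(n+1)`-cells. -/
def extend : Precat.{u} (n + 1 : ℕ) where
  toGlobularSet := L.extGlob
  idn := extIdn
  comp i m _ _ u v h := extComp i m u v h
  bd_idn ε k k' h u := by
    cases u with
    | old hk c =>
      by_cases hk' : k'.1 ≤ n
      · rw [extIdn_old _ _ _ hk']
        exact congrArg _ (C.bd_idn ε (k := ⟨k.1, _⟩) (k' := ⟨k'.1, _⟩) h c)
      · obtain ⟨k, _⟩ := k
        obtain ⟨k', hk''⟩ := k'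
        have h1 : k' ≤ n + 1 := Nat.cast_le.mp hk''
        dsimp only at h hk hk'
        obtain rfl : k = n := by omega
        subst h
        rw [extIdn_top]
        exact (extGlob_bd_top_self (k := ⟨k + 1, hk''⟩) (Nat.le_succ k) rfl (L.idn c)).trans
          (congrArg _ (L.bd_idn ε c))
    | top hk t => have := Dim.le k'; omega
  bd_comp_lt ε {i j k l} hkl hj u v h h' := by
    rcases u with ⟨hk, u⟩ | ⟨hk, u⟩ <;> rcases v with ⟨hl, v⟩ | ⟨hl, v⟩
    · exact congrArg _ (C.bd_comp_lt ε (i := ⟨i.1, _⟩) (j := ⟨j.1, _⟩) (k := ⟨k.1, _⟩)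
        (l := ⟨l.1, _⟩) hkl hj u v (comp_old_old h) (comp_old_old h'))
    · obtain ⟨j, hj'⟩ := j
      obtain rfl : j = n := by dsimp only at hj; omega
      revert h'
      simp only [extGlob_bd_top_self]
      intro h'
      exact (extGlob_bd_top_self _ _ _).trans (congrArg _ (L.bd_lw ε _ _ _))
    · omega
    · omega
  bd_comp_gt ε {i j k l} hkl hj u v h h' := by
    rcases u with ⟨hk, u⟩ | ⟨hk, u⟩ <;> rcases v with ⟨hl, v⟩ | ⟨hl, v⟩
    · exact congrArg _ (C.bd_comp_gt ε (i := ⟨i.1, _⟩) (j := ⟨j.1, _⟩) (k := ⟨k.1, _⟩)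
        (l := ⟨l.1, _⟩) hkl hj u v (comp_old_old h) (comp_old_old h'))
    · omega
    · obtain ⟨j, hj'⟩ := j
      obtain rfl : j = n := by dsimp only at hj; omega
      revert h'
      simp only [extGlob_bd_top_self]
      intro h'
      exact (extGlob_bd_top_self _ _ _).trans (congrArg _ (L.bd_rw ε _ _ _))
    · omega
  src_comp {i k} hi u v h := by
    rcases u with ⟨hk, u⟩ | ⟨hk, u⟩ <;> rcases v with ⟨hl, v⟩ | ⟨hl, v⟩
    · exact congrArg _ (C.src_comp (i := ⟨i.1, _⟩) (k := ⟨k.1, _⟩) hi u v (comp_old_old h))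
    · omega
    · omega
    · obtain ⟨i, hi'⟩ := i
      obtain rfl : i = n := by dsimp only at hi; omega
      exact (extGlob_bd_top_self (k := k) (by omega) hk _).trans
        ((congrArg _ (L.bd_comp false _ _ _)).trans (extGlob_bd_top_self (k := k) (by omega) hk _).symm)
  tgt_comp {i k} hi u v h := by
    rcases u with ⟨hk, u⟩ | ⟨hk, u⟩ <;> rcases v with ⟨hl, v⟩ | ⟨hl, v⟩
    · exact congrArg _ (C.tgt_comp (i := ⟨i.1, _⟩) (k := ⟨k.1, _⟩) hi u v (comp_old_old h))
    · omega
    · omega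
    · obtain ⟨i, hi'⟩ := i
      obtain rfl : i = n := by dsimp only at hi; omega
      exact (extGlob_bd_top_self (k := k) (by omega) hk _).trans
        ((congrArg _ (L.bd_comp true _ _ _)).trans (extGlob_bd_top_self (k := k) (by omega) hk _).symm)
  idn_comp {i k k' l} h hl u v c := by
    have hi := c.hi
    rcases u with ⟨hu, u⟩ | ⟨hu, u⟩
    swap
    · have := Dim.le k'; omega
    by_cases hk' : k'.1 ≤ n
    · revert c
      simp only [extIdn_old _ _ _ hk']
      intro c
      obtain ⟨k, _⟩ := k
      obtain ⟨i, _⟩ := i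
      obtain rfl : i = k := by dsimp only at hi h; omega
      rcases v with ⟨hv, v⟩ | ⟨hv, v⟩
      · exact congrArg _ (C.idn_comp (i := ⟨i, _⟩) (k := ⟨i, _⟩) (k' := ⟨k'.1, _⟩)
          (l := ⟨l.1, _⟩) h hl u v (comp_old_old c))
      · exact congrArg _ (L.idn_lw (i := ⟨i, _⟩) (k := ⟨k'.1, _⟩) h u v (comp_old_top c))
    · obtain ⟨k, _⟩ := k
      obtain ⟨k', hk''⟩ := k'
      have h1 : k' ≤ n + 1 := Nat.cast_le.mp hk''
      have h2 := Dim.le l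
      dsimp only at h hk' hu
      obtain rfl : k = n := by omega
      subst h
      rcases v with ⟨hv, v⟩ | ⟨hv, v⟩
      · dsimp only at hl; omega
      · revert c
        simp only [extIdn_top]
        intro c
        exact congrArg _ (L.idn_comp _ _ _)
  comp_idn {i k l l'} h hl u v c := by
    have hi := c.hi
    rcases v with ⟨hv, v⟩ | ⟨hv, v⟩
    swap
    · have := Dim.le l'; omega
    by_cases hl' : l'.1 ≤ n
    · revert c
      simp only [extIdn_old _ _ _ hl']
      intro c
      obtain ⟨l, _⟩ := l
      obtain ⟨i, _⟩ := i
      obtain rfl : i = l := by dsimp only at hi h; omega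
      rcases u with ⟨hu, u⟩ | ⟨hu, u⟩
      · exact congrArg _ (C.comp_idn (i := ⟨i, _⟩) (l := ⟨i, _⟩) (l' := ⟨l'.1, _⟩)
          (k := ⟨k.1, _⟩) h hl u v (comp_old_old c))
      · exact congrArg _ (L.rw_of_idn (i := ⟨i, _⟩) (k := ⟨l'.1, _⟩) h v u (comp_top_old c))
    · obtain ⟨l, _⟩ := l
      obtain ⟨l', hl''⟩ := l'
      have h1 : l' ≤ n + 1 := Nat.cast_le.mp hl''
      have h2 := Dim.le k
      dsimp only at h hl' hv
      obtain rfl : l = n := by omega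
      subst h
      rcases u with ⟨hu, u⟩ | ⟨hu, u⟩
      · dsimp only at hl; omega
      · revert c
        simp only [extIdn_top]
        intro c
        exact congrArg _ (L.comp_idn _ _ _)
  idn_comp' {i k k' l} h hl u v c c' := by
    have hi := c.hi
    have h2 := Dim.le k'
    rcases u with ⟨hu, u⟩ | ⟨hu, u⟩
    swap
    · omega
    rcases v with ⟨hv, v⟩ | ⟨hv, v⟩
    swap
    · omega
    by_cases hk' : k'.1 ≤ n
    · revert c
      simp only [extIdn_old _ _ _ hk']
      intro c
      exact (congrArg _ (C.idn_comp' (i := ⟨i.1, _⟩) (k := ⟨k.1, _⟩) (k' := ⟨k'.1, _⟩)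
          (l := ⟨l.1, _⟩) h hl u v (comp_old_old c) (comp_old_old c'))).trans
          (extIdn_old _ _ _ hk').symm
    · obtain ⟨k, _⟩ := k
      obtain ⟨k', hk''⟩ := k'
      dsimp only at h hk' hu
      obtain rfl : k = n := by omega
      subst h
      revert c
      simp only [extIdn_top]
      intro c
      exact (congrArg _ (L.rw_idn (i := ⟨i.1, _⟩) v u _ (comp_old_old c'))).trans (extIdn_top _).symm
  comp_idn' {i k l l'} h hl u v c c' := by
    have hi := c.hi
    have h2 := Dim.le l'
    rcases v with ⟨hv, v⟩ | ⟨hv, v⟩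
    swap
    · omega
    rcases u with ⟨hu, u⟩ | ⟨hu, u⟩
    swap
    · omega
    by_cases hl' : l'.1 ≤ n
    · revert c
      simp only [extIdn_old _ _ _ hl']
      intro c
      exact (congrArg _ (C.comp_idn' (i := ⟨i.1, _⟩) (k := ⟨k.1, _⟩) (l := ⟨l.1, _⟩)
          (l' := ⟨l'.1, _⟩) h hl u v (comp_old_old c) (comp_old_old c'))).trans
          (extIdn_old _ _ _ hl').symm
    · obtain ⟨l, _⟩ := l
      obtain ⟨l', hl''⟩ := l'
      dsimp only at h hl' hv
      obtain rfl : l = n := by omega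
      subst h
      revert c
      simp only [extIdn_top]
      intro c
      exact (congrArg _ (L.lw_idn (i := ⟨i.1, _⟩) u v _ (comp_old_old c'))).trans (extIdn_top _).symm
  assoc {i k l m p q r} u v w h₁ h₂ h₃ h₄ := by
    have a₁ := h₁.hi
    have b₁ := h₁.hm
    have a₂ := h₂.hi
    have a₃ := h₃.hi
    have b₃ := h₃.hm
    have a₄ := h₄.hi
    rcases u with ⟨hu, u⟩ | ⟨hu, u⟩ <;> rcases v with ⟨hv, v⟩ | ⟨hv, v⟩ <;>
      rcases w with ⟨hw, w⟩ | ⟨hw, w⟩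
    · exact congrArg _ (C.assoc (i := ⟨i.1, _⟩) (k := ⟨k.1, _⟩) (l := ⟨l.1, _⟩)
          (m := ⟨m.1, _⟩) (p := ⟨p.1, _⟩) (q := ⟨q.1, _⟩) (r := ⟨r.1, _⟩) u v w (comp_old_old h₁)
          (comp_old_old h₂) (comp_old_old h₃) (comp_old_old h₄))
    · exact congrArg _ (L.lw_lw (i := ⟨i.1, _⟩) u v w (comp_old_old h₁)
          (comp_old_top h₂) (comp_old_top h₃) (comp_old_top h₄))
    · exact congrArg _ (L.lw_rw (i := ⟨i.1, _⟩) u w v (comp_old_top h₁)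
          (comp_top_old h₂) (comp_top_old h₃) (comp_old_top h₄))
    · omega
    · exact congrArg _ (L.rw_rw (i := ⟨i.1, _⟩) v w u (comp_top_old h₁)
          (comp_top_old h₂) (comp_old_old h₃) (comp_top_old h₄))
    · omega
    · omega
    · exact congrArg _ (L.assoc u v w (comp_top_top h₁)
          (comp_top_top h₂) (comp_top_top h₃) (comp_top_top h₄))
  distrib_left {i j k l l' m} hij u v w h₁ h₂ h₃ h₄ h₅ := by
    have a₁ := h₁.hi
    have b₁ := h₁.hm
    have a₂ := h₂.hi
    have a₃ := h₃.hi
    have b₃ := h₃.hm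
    have a₄ := h₄.hi
    have b₄ := h₄.hm
    have a₅ := h₅.hi
    rcases u with ⟨hu, u⟩ | ⟨hu, u⟩ <;> rcases v with ⟨hv, v⟩ | ⟨hv, v⟩ <;>
      rcases w with ⟨hw, w⟩ | ⟨hw, w⟩
    · exact congrArg _ (C.distrib_left (i := ⟨i.1, _⟩) (j := ⟨j.1, _⟩) (k := ⟨k.1, _⟩)
        (l := ⟨l.1, _⟩) (l' := ⟨l'.1, _⟩) (m := ⟨m.1, _⟩) hij u v w (comp_old_old h₁)
          (comp_old_old h₂) (comp_old_old h₃) (comp_old_old h₄) (comp_old_old h₅))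
    · exact congrArg _ (L.lw_distrib_lw (i := ⟨i.1, _⟩) (j := ⟨j.1, _⟩) hij u v w
        (comp_old_top h₁) (comp_old_top h₂) (comp_old_old h₃) (comp_old_top h₄) (comp_old_top h₅))
    · exact congrArg _ (L.lw_distrib_rw (i := ⟨i.1, _⟩) (j := ⟨j.1, _⟩) hij u w v
        (comp_top_old h₁) (comp_old_top h₂) (comp_old_old h₄) (comp_old_top h₃) (comp_top_old h₅))
    · exact congrArg _ (L.lw_comp (i := ⟨i.1, _⟩) u v w
        (comp_top_top h₁) (comp_old_top h₂) (comp_old_top h₃) (comp_old_top h₄) (comp_top_top h₅))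
    all_goals omega
  distrib_right {i j k l l' m} hij v w u h₁ h₂ h₃ h₄ h₅ := by
    have a₁ := h₁.hi
    have b₁ := h₁.hm
    have a₂ := h₂.hi
    have a₃ := h₃.hi
    have b₃ := h₃.hm
    have a₄ := h₄.hi
    have b₄ := h₄.hm
    have a₅ := h₅.hi
    rcases u with ⟨hu, u⟩ | ⟨hu, u⟩ <;> rcases v with ⟨hv, v⟩ | ⟨hv, v⟩ <;>
      rcases w with ⟨hw, w⟩ | ⟨hw, w⟩
    · exact congrArg _ (C.distrib_right (i := ⟨i.1, _⟩) (j := ⟨j.1, _⟩) (k := ⟨k.1, _⟩)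
        (l := ⟨l.1, _⟩) (l' := ⟨l'.1, _⟩) (m := ⟨m.1, _⟩) hij v w u (comp_old_old h₁)
          (comp_old_old h₂) (comp_old_old h₃) (comp_old_old h₄) (comp_old_old h₅))
    · exact congrArg _ (L.rw_distrib_lw (i := ⟨i.1, _⟩) (j := ⟨j.1, _⟩) hij u v w
        (comp_old_top h₁) (comp_top_old h₂) (comp_old_old h₃) (comp_top_old h₄) (comp_old_top h₅))
    · exact congrArg _ (L.rw_distrib_rw (i := ⟨i.1, _⟩) (j := ⟨j.1, _⟩) hij u w v
        (comp_top_old h₁) (comp_top_old h₂) (comp_old_old h₄) (comp_top_old h₃) (comp_top_old h₅))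
    · exact congrArg _ (L.rw_comp (i := ⟨i.1, _⟩) u v w
        (comp_top_top h₁) (comp_top_old h₂) (comp_top_old h₃) (comp_top_old h₄) (comp_top_top h₅))
    all_goals omega

end Layer

end Precat

namespace Precat

/-- A set of `(n+1)`-generators over an `n`-precategory, each having a source and a target which are
parallel `n`-cells. -/
structure Gens {n : ℕ} (C : Precat.{u} n) where
  gen : Type u
  bd : Bool → gen → C.cell (top n)
  par : ∀ (ε : Bool) (j : Dim n) (h : j.1 < n) (g : gen),
    C.bd ε j (bd false g) h.le = C.bd ε j (bd true g) h.le

namespace Gens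

variable {n : ℕ} {C : Precat.{u} n} (X : Gens C)

/-- The formal `(n+1)`-cells generated by `X`, with given source and target. -/
inductive Term : C.cell (top n) → C.cell (top n) → Type u
  | gen (g : X.gen) : Term (X.bd false g) (X.bd true g)
  | idn (c : C.cell (top n)) : Term c c
  | comp {a b b' c : C.cell (top n)} (h : b = b') (p : Term a b) (q : Term b' c) : Term a c
  | lw {i k : Dim n} (u : C.cell k) {a b : C.cell (top n)} (ha : C.Composable i (top n) u a)
      (hb : C.Composable i (top n) u b) (p : Term a b) :
      Term (C.comp i _ u a ha) (C.comp i _ u b hb)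
  | rw {i k : Dim n} (u : C.cell k) {a b : C.cell (top n)} (ha : C.Composable i (top n) a u)
      (hb : C.Composable i (top n) b u) (p : Term a b) :
      Term (C.comp i _ a u ha) (C.comp i _ b u hb)

variable {X}

theorem _root_.GlobularSet.Composable.bd_right {n : ℕ∞} {X : GlobularSet.{u} n} {i l k : Dim n}
    {u : X.cell k} {v : X.cell l} (h : X.Composable i l u v) (ε : Bool) {j : Dim n}
    (hj : j.1 + 1 = l.1) (hkl : k.1 < l.1) : X.Composable i j u (X.bd ε j v (by omega)) :=
  have := h.hi
  ⟨by omega, by omega, by rw [h.eq, X.bd_bd _ _ (by omega)]⟩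

theorem _root_.GlobularSet.Composable.bd_left {n : ℕ∞} {X : GlobularSet.{u} n} {i l k : Dim n}
    {u : X.cell k} {v : X.cell l} (h : X.Composable i l v u) (ε : Bool) {j : Dim n}
    (hj : j.1 + 1 = l.1) (hkl : k.1 < l.1) : X.Composable i j (X.bd ε j v (by omega)) u :=
  have := h.hi
  ⟨by omega, by omega, by rw [← h.eq, X.bd_bd _ _ (by omega)]⟩

theorem par_of_step {c d : C.cell (top n)} (H : ∀ (ε : Bool) (j : Dim n) (h : j.1 + 1 = n),
    C.bd ε j c (by dsimp only; omega) = C.bd ε j d (by dsimp only; omega))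
    (ε : Bool) (j : Dim n) (h : j.1 < n) : C.bd ε j c h.le = C.bd ε j d h.le := by
  by_cases h' : j.1 + 1 = n
  · exact H ε j h'
  · have hn : ((n - 1 : ℕ) : ℕ∞) ≤ n := Nat.cast_le.mpr (Nat.sub_le n 1)
    have hj : j.1 < n - 1 := by omega
    have := H ε ⟨n - 1, hn⟩ (by dsimp only; omega)
    rw [← C.bd_bd ε ε (i := j) (j := ⟨n - 1, hn⟩) hj (Nat.sub_le n 1), this,
      C.bd_bd ε ε (i := j) (j := ⟨n - 1, hn⟩) hj (Nat.sub_le n 1)]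

theorem Term.par {a b : C.cell (top n)} (t : X.Term a b) (ε : Bool) (j : Dim n) (h : j.1 < n) :
    C.bd ε j a h.le = C.bd ε j b h.le := by
  induction t generalizing ε j with
  | gen g => exact X.par ε j h g
  | idn c => rfl
  | comp e p q hp hq =>
    subst e
    rw [hp ε j h, hq ε j h]
  | @lw i k u a b ha hb p ih =>
    refine par_of_step ?_ ε j h
    clear h j ε
    intro ε j h
    have hi := ha.hi
    have hkn := Dim.le k
    rcases Nat.lt_or_ge k.1 n with hk | hk
    · rw [C.bd_comp_lt ε (l := top n) hk h u a ha (ha.bd_right ε h hk),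
        C.bd_comp_lt ε (l := top n) hk h u b hb (hb.bd_right ε h hk)]
      congr 1
      exact ih ε j (by omega)
    · obtain ⟨k, hk'⟩ := k
      obtain ⟨i, hi'⟩ := i
      obtain ⟨j, hj'⟩ := j
      dsimp only at hi h hk hkn
      obtain rfl : k = n := by omega
      obtain rfl : i = j := by omega
      cases ε
      · rw [C.src_comp (k := top k) h, C.src_comp (k := top k) h]
      · rw [C.tgt_comp (k := top k) h, C.tgt_comp (k := top k) h]
        exact ih true ⟨i, hi'⟩ (by dsimp only; omega)
  | @rw i k u a b ha hb p ih =>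
    refine par_of_step ?_ ε j h
    clear h j ε
    intro ε j h
    have hi := ha.hi
    have hkn := Dim.le k
    rcases Nat.lt_or_ge k.1 n with hk | hk
    · rw [C.bd_comp_gt ε (k := top n) hk h a u ha (ha.bd_left ε h hk),
        C.bd_comp_gt ε (k := top n) hk h b u hb (hb.bd_left ε h hk)]
      congr 1
      exact ih ε j (by omega)
    · obtain ⟨k, hk'⟩ := k
      obtain ⟨i, hi'⟩ := i
      obtain ⟨j, hj'⟩ := j
      dsimp only at hi h hk hkn
      obtain rfl : k = n := by omega
      obtain rfl : i = j := by omega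
      cases ε
      · rw [C.src_comp (k := top k) h, C.src_comp (k := top k) h]
        exact ih false ⟨i, hi'⟩ (by dsimp only; omega)
      · rw [C.tgt_comp (k := top k) h, C.tgt_comp (k := top k) h]

/-- The congruence on formal cells generated by the axioms of precategories. -/
inductive Rel : ∀ {a b a' b' : C.cell (top n)}, X.Term a b → X.Term a' b' → Prop
  | refl {a b} (p : X.Term a b) : Rel p p
  | symm {a b a' b'} {p : X.Term a b} {q : X.Term a' b'} : Rel p q → Rel q p
  | trans {a b a' b' a'' b''} {p : X.Term a b} {q : X.Term a' b'} {r : X.Term a'' b''} :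
      Rel p q → Rel q r → Rel p r
  | comp_congr {a b b' c a₁ b₁ b₁' c₁} {h : b = b'} {h₁ : b₁ = b₁'} {p : X.Term a b}
      {q : X.Term b' c} {p₁ : X.Term a₁ b₁} {q₁ : X.Term b₁' c₁} :
      Rel p p₁ → Rel q q₁ → Rel (.comp h p q) (.comp h₁ p₁ q₁)
  | lw_congr {i k : Dim n} {u : C.cell k} {a b a₁ b₁} {ha hb ha₁ hb₁} {p : X.Term a b}
      {p₁ : X.Term a₁ b₁} : Rel p p₁ → Rel (.lw (i := i) u ha hb p) (.lw (i := i) u ha₁ hb₁ p₁)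
  | rw_congr {i k : Dim n} {u : C.cell k} {a b a₁ b₁} {ha hb ha₁ hb₁} {p : X.Term a b}
      {p₁ : X.Term a₁ b₁} : Rel p p₁ → Rel (.rw (i := i) u ha hb p) (.rw (i := i) u ha₁ hb₁ p₁)
  | idn_comp {a b c} (h : c = a) (p : X.Term a b) : Rel (.comp h (.idn c) p) p
  | comp_idn {a b c} (h : b = c) (p : X.Term a b) : Rel (.comp h p (.idn c)) p
  | assoc {a b b' c c' d} {h : b = b'} {h' : c = c'} (p : X.Term a b) (q : X.Term b' c)
      (r : X.Term c' d) : Rel (.comp h' (.comp h p q) r) (.comp h p (.comp h' q r))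
  | lw_idn {i k : Dim n} (u : C.cell k) (c) (h) :
      Rel (.lw (i := i) u h h (.idn c)) (.idn (C.comp i _ u c h))
  | rw_idn {i k : Dim n} (u : C.cell k) (c) (h) :
      Rel (.rw (i := i) u h h (.idn c)) (.idn (C.comp i _ c u h))
  | idn_lw {i k : Dim n} (hi : i.1 + 1 = k.1) (x : C.cell i) {a b} (p : X.Term a b) (ha hb) :
      Rel (.lw (i := i) (C.idn (k' := k) hi x) ha hb p) p
  | rw_of_idn {i k : Dim n} (hi : i.1 + 1 = k.1) (x : C.cell i) {a b} (p : X.Term a b) (ha hb) :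
      Rel (.rw (i := i) (C.idn (k' := k) hi x) ha hb p) p
  | lw_lw {i k l m : Dim n} (u : C.cell k) (v : C.cell l) {a b} (p : X.Term a b)
      (h₁ h₂ h₂' h₃ h₃' h₄ h₄') :
      Rel (.lw (i := i) (C.comp i m u v h₁) h₂ h₂' p) (.lw (i := i) u h₄ h₄' (.lw (i := i) v h₃ h₃' p))
  | lw_rw {i k l : Dim n} (u : C.cell k) (v : C.cell l) {a b} (p : X.Term a b)
      (h₁ h₁' h₂ h₂' h₃ h₃' h₄ h₄') :
      Rel (.rw (i := i) v h₂ h₂' (.lw (i := i) u h₁ h₁' p))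
        (.lw (i := i) u h₄ h₄' (.rw (i := i) v h₃ h₃' p))
  | rw_rw {i k l m : Dim n} (u : C.cell k) (v : C.cell l) {a b} (p : X.Term a b)
      (h₁ h₁' h₂ h₂' h₃ h₄ h₄') :
      Rel (.rw (i := i) v h₂ h₂' (.rw (i := i) u h₁ h₁' p)) (.rw (i := i) (C.comp i m u v h₃) h₄ h₄' p)
  | lw_comp {i k : Dim n} (u : C.cell k) {a b b' c} {h : b = b'} (p : X.Term a b)
      (q : X.Term b' c) (h₂ h₂' h₃ h₃' h₄ h₄' h₅) :
      Rel (.lw (i := i) u h₂ h₂' (.comp h p q))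
        (.comp h₅ (.lw (i := i) u h₃ h₃' p) (.lw (i := i) u h₄ h₄' q))
  | rw_comp {i k : Dim n} (u : C.cell k) {a b b' c} {h : b = b'} (p : X.Term a b)
      (q : X.Term b' c) (h₂ h₂' h₃ h₃' h₄ h₄' h₅) :
      Rel (.rw (i := i) u h₂ h₂' (.comp h p q))
        (.comp h₅ (.rw (i := i) u h₃ h₃' p) (.rw (i := i) u h₄ h₄' q))
  | lw_distrib_lw {i j k l : Dim n} (_ : i.1 < j.1) (u : C.cell k) (v : C.cell l) {a b}
      (p : X.Term a b) (h₁ h₁' h₂ h₂' h₃ h₄ h₄' h₅ h₅') :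
      Rel (.lw (i := i) u h₂ h₂' (.lw (i := j) v h₁ h₁' p))
        (.lw (i := j) (C.comp i l u v h₃) h₅ h₅' (.lw (i := i) u h₄ h₄' p))
  | lw_distrib_rw {i j k l : Dim n} (_ : i.1 < j.1) (u : C.cell k) (v : C.cell l) {a b}
      (p : X.Term a b) (h₁ h₁' h₂ h₂' h₃ h₄ h₄' h₅ h₅') :
      Rel (.lw (i := i) u h₂ h₂' (.rw (i := j) v h₁ h₁' p))
        (.rw (i := j) (C.comp i l u v h₃) h₅ h₅' (.lw (i := i) u h₄ h₄' p))
  | rw_distrib_lw {i j k l : Dim n} (_ : i.1 < j.1) (u : C.cell k) (v : C.cell l) {a b}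
      (p : X.Term a b) (h₁ h₁' h₂ h₂' h₃ h₄ h₄' h₅ h₅') :
      Rel (.rw (i := i) u h₂ h₂' (.lw (i := j) v h₁ h₁' p))
        (.lw (i := j) (C.comp i l v u h₃) h₅ h₅' (.rw (i := i) u h₄ h₄' p))
  | rw_distrib_rw {i j k l : Dim n} (_ : i.1 < j.1) (u : C.cell k) (v : C.cell l) {a b}
      (p : X.Term a b) (h₁ h₁' h₂ h₂' h₃ h₄ h₄' h₅ h₅') :
      Rel (.rw (i := i) u h₂ h₂' (.rw (i := j) v h₁ h₁' p))
        (.rw (i := j) (C.comp i l v u h₃) h₅ h₅' (.rw (i := i) u h₄ h₄' p))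

theorem Rel.bd_eq {a b a' b' : C.cell (top n)} {p : X.Term a b} {q : X.Term a' b'} (h : Rel p q) :
    a = a' ∧ b = b' := by
  induction h with
  | refl p => exact ⟨rfl, rfl⟩
  | symm _ h => exact ⟨h.1.symm, h.2.symm⟩
  | trans _ _ h h' => exact ⟨h.1.trans h'.1, h.2.trans h'.2⟩
  | comp_congr _ _ h h' => exact ⟨h.1, h'.2⟩
  | lw_congr _ h => obtain ⟨rfl, rfl⟩ := h; exact ⟨rfl, rfl⟩
  | rw_congr _ h => obtain ⟨rfl, rfl⟩ := h; exact ⟨rfl, rfl⟩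
  | idn_comp h p => exact ⟨h, rfl⟩
  | comp_idn h p => exact ⟨rfl, h.symm⟩
  | assoc p q r => exact ⟨rfl, rfl⟩
  | lw_idn u c h => exact ⟨rfl, rfl⟩
  | rw_idn u c h => exact ⟨rfl, rfl⟩
  | @idn_lw i k hi x a b p ha hb => exact ⟨C.idn_comp hi (Dim.le k) _ _ _, C.idn_comp hi (Dim.le k) _ _ _⟩
  | @rw_of_idn i k hi x a b p ha hb => exact ⟨C.comp_idn hi (Dim.le k) _ _ _, C.comp_idn hi (Dim.le k) _ _ _⟩
  | lw_lw => exact ⟨C.assoc _ _ _ _ _ _ _, C.assoc _ _ _ _ _ _ _⟩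
  | lw_rw => exact ⟨C.assoc _ _ _ _ _ _ _, C.assoc _ _ _ _ _ _ _⟩
  | rw_rw => exact ⟨C.assoc _ _ _ _ _ _ _, C.assoc _ _ _ _ _ _ _⟩
  | lw_comp => exact ⟨rfl, rfl⟩
  | rw_comp => exact ⟨rfl, rfl⟩
  | lw_distrib_lw h => exact ⟨C.distrib_left h .., C.distrib_left h ..⟩
  | lw_distrib_rw h => exact ⟨C.distrib_left h .., C.distrib_left h ..⟩
  | rw_distrib_lw h => exact ⟨C.distrib_right h .., C.distrib_right h ..⟩
  | rw_distrib_rw h => exact ⟨C.distrib_right h .., C.distrib_right h ..⟩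

variable (X)

/-- The formal cells together with their source and target. -/
structure Raw where
  {src tgt : C.cell (top n)}
  term : X.Term src tgt

instance rawSetoid : Setoid X.Raw where
  r p q := Rel p.term q.term
  iseqv := ⟨fun p => .refl p.term, .symm, .trans⟩

variable {X}

/-- The source and the target of a formal cell. -/
def Raw.bd (ε : Bool) (p : X.Raw) : C.cell (top n) := bif ε then p.tgt else p.src

/-- The free `(n+1)`-cells. -/
abbrev Free (X : Gens C) : Type u := _root_.Quotient X.rawSetoid

/-- The source and the target of a free cell. -/
def Free.bd (ε : Bool) (p : Free X) : C.cell (top n) :=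
  p.lift (Raw.bd ε) fun _ _ h => by cases ε; exacts [(Rel.bd_eq h).1, (Rel.bd_eq h).2]

/-- The class of a formal cell. -/
def Free.mk {a b : C.cell (top n)} (p : X.Term a b) : Free X := _root_.Quotient.mk _ ⟨p⟩

theorem Free.sound {a b a' b' : C.cell (top n)} {p : X.Term a b} {q : X.Term a' b'} (h : Rel p q) :
    Free.mk p = Free.mk q := _root_.Quotient.sound h

theorem Free.exact {a b a' b' : C.cell (top n)} {p : X.Term a b} {q : X.Term a' b'}
    (h : Free.mk p = Free.mk q) : Rel p q := _root_.Quotient.exact h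

theorem Free.ind {motive : Free X → Prop} (h : ∀ {a b} (p : X.Term a b), motive (.mk p)) (p) :
    motive p := _root_.Quotient.ind (fun p => h p.term) p

theorem Free.out_rel {a b : C.cell (top n)} (p : X.Term a b) :
    Rel (_root_.Quotient.out (Free.mk p)).term p :=
  _root_.Quotient.mk_out (s := X.rawSetoid) ⟨p⟩

theorem Free.bd_out (ε : Bool) (p : Free X) : p.out.bd ε = p.bd ε := by
  conv_rhs => rw [← _root_.Quotient.out_eq p]
  rfl

/-- Composition `⋆_n` of free cells. -/
noncomputable def Free.comp (p q : Free X) (h : p.bd true = q.bd false) : Free X :=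
  .mk (.comp (by rw [← Free.bd_out, ← Free.bd_out] at h; exact h) p.out.term q.out.term)

/-- Left whiskering of free cells. -/
noncomputable def Free.lw {i k : Dim n} (u : C.cell k) (p : Free X)
    (h : ∀ ε, C.Composable i (top n) u (p.bd ε)) : Free X :=
  .mk (.lw (i := i) u (by simp only [← Free.bd_out] at h; exact h false)
    (by simp only [← Free.bd_out] at h; exact h true) p.out.term)

/-- Right whiskering of free cells. -/
noncomputable def Free.rw {i k : Dim n} (p : Free X) (u : C.cell k)
    (h : ∀ ε, C.Composable i (top n) (p.bd ε) u) : Free X :=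
  .mk (.rw (i := i) u (by simp only [← Free.bd_out] at h; exact h false)
    (by simp only [← Free.bd_out] at h; exact h true) p.out.term)

theorem Free.comp_mk {a b b' c : C.cell (top n)} (p : X.Term a b) (q : X.Term b' c) (h) :
    Free.comp (.mk p) (.mk q) h = .mk (.comp h p q) :=
  sound (.comp_congr (out_rel p) (out_rel q))

theorem Free.lw_mk {i k : Dim n} (u : C.cell k) {a b : C.cell (top n)} (p : X.Term a b) (h) :
    Free.lw (i := i) u (.mk p) h = .mk (.lw (i := i) u (h false) (h true) p) :=
  sound (.lw_congr (out_rel p))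

theorem Free.rw_mk {i k : Dim n} (u : C.cell k) {a b : C.cell (top n)} (p : X.Term a b) (h) :
    Free.rw (i := i) (.mk p) u h = .mk (.rw (i := i) u (h false) (h true) p) :=
  sound (.rw_congr (out_rel p))

/-- The layer of free `(n+1)`-cells. -/
noncomputable def freeLayer (X : Gens C) : Layer C where
  T := Free X
  bd := Free.bd
  par ε j h p := by
    induction p using Free.ind with | h p => exact p.par ε j h
  idn c := .mk (.idn c)
  comp := Free.comp
  lw := Free.lw
  rw := Free.rw
  bd_idn ε c := by cases ε <;> rfl
  bd_comp ε p q h := by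
    induction p using Free.ind with | h p => ?_
    induction q using Free.ind with | h q => ?_
    rw [Free.comp_mk]; cases ε <;> rfl
  bd_lw ε i k u p h := by
    induction p using Free.ind with | h p => ?_
    rw [Free.lw_mk]; cases ε <;> rfl
  bd_rw ε i k u p h := by
    induction p using Free.ind with | h p => ?_
    rw [Free.rw_mk]; cases ε <;> rfl
  idn_comp c p h := by
    induction p using Free.ind with | h p => ?_
    rw [Free.comp_mk]; exact Free.sound (.idn_comp _ _)
  comp_idn c p h := by
    induction p using Free.ind with | h p => ?_
    rw [Free.comp_mk]; exact Free.sound (.comp_idn _ _)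
  assoc p q r h₁ h₂ h₃ h₄ := by
    induction p using Free.ind with | h p => ?_
    induction q using Free.ind with | h q => ?_
    induction r using Free.ind with | h r => ?_
    simp only [Free.comp_mk]; exact Free.sound (.assoc _ _ _)
  lw_idn u c h h' := by rw [Free.lw_mk]; exact Free.sound (.lw_idn _ _ _)
  rw_idn u c h h' := by rw [Free.rw_mk]; exact Free.sound (.rw_idn _ _ _)
  idn_lw hi x p h := by
    induction p using Free.ind with | h p => ?_
    rw [Free.lw_mk]; exact Free.sound (.idn_lw ..)
  rw_of_idn hi x p h := by
    induction p using Free.ind with | h p => ?_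
    rw [Free.rw_mk]; exact Free.sound (.rw_of_idn ..)
  lw_lw u v p h₁ h₂ h₃ h₄ := by
    induction p using Free.ind with | h p => ?_
    simp only [Free.lw_mk]; exact Free.sound (.lw_lw ..)
  lw_rw u v p h₁ h₂ h₃ h₄ := by
    induction p using Free.ind with | h p => ?_
    simp only [Free.lw_mk, Free.rw_mk]; exact Free.sound (.lw_rw ..)
  rw_rw u v p h₁ h₂ h₃ h₄ := by
    induction p using Free.ind with | h p => ?_
    simp only [Free.rw_mk]; exact Free.sound (.rw_rw ..)
  lw_comp u p q h₁ h₂ h₃ h₄ h₅ := by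
    induction p using Free.ind with | h p => ?_
    induction q using Free.ind with | h q => ?_
    simp only [Free.lw_mk, Free.comp_mk]; exact Free.sound (.lw_comp ..)
  rw_comp u p q h₁ h₂ h₃ h₄ h₅ := by
    induction p using Free.ind with | h p => ?_
    induction q using Free.ind with | h q => ?_
    simp only [Free.rw_mk, Free.comp_mk]; exact Free.sound (.rw_comp ..)
  lw_distrib_lw hij u v p h₁ h₂ h₃ h₄ h₅ := by
    induction p using Free.ind with | h p => ?_
    simp only [Free.lw_mk]; exact Free.sound (.lw_distrib_lw hij ..)
  lw_distrib_rw hij u v p h₁ h₂ h₃ h₄ h₅ := by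
    induction p using Free.ind with | h p => ?_
    simp only [Free.lw_mk, Free.rw_mk]; exact Free.sound (.lw_distrib_rw hij ..)
  rw_distrib_lw hij u v p h₁ h₂ h₃ h₄ h₅ := by
    induction p using Free.ind with | h p => ?_
    simp only [Free.lw_mk, Free.rw_mk]; exact Free.sound (.rw_distrib_lw hij ..)
  rw_distrib_rw hij u v p h₁ h₂ h₃ h₄ h₅ := by
    induction p using Free.ind with | h p => ?_
    simp only [Free.rw_mk]; exact Free.sound (.rw_distrib_rw hij ..)

/-- The `(n+1)`-precategory `C[X]` freely generated by an `n`-precategory `C` and a set `X` of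
`(n+1)`-generators over it. -/
noncomputable def freeExt (X : Gens C) : Precat.{u} (n + 1 : ℕ) := X.freeLayer.extend

end Gens
end Precat

namespace Precat

variable {n : ℕ}

theorem le_succ' (n : ℕ) : (n : ℕ∞) ≤ (n + 1 : ℕ) := Nat.cast_le.mpr (Nat.le_succ n)

/-- The `n`-truncation of an `(n+1)`-precategory. -/
abbrev truncSucc (n : ℕ) : Precat.{u} (n + 1 : ℕ) ⥤ Precat.{u} n := trunc (le_succ' n)

theorem bd_bd_same {m : ℕ∞} (E : Precat.{u} m) (ε : Bool) {i j k : Dim m} (hij : i.1 ≤ j.1)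
    (hjk : j.1 ≤ k.1) (x : E.cell k) :
    E.bd ε i (E.bd ε j x hjk) hij = E.bd ε i x (hij.trans hjk) := by
  rcases hij.lt_or_eq with h | h
  · exact E.bd_bd ε ε h hjk x
  · obtain rfl : i = j := Subtype.ext h
    exact E.bd_self ε _

section restr

variable {C : Precat.{u} n} {E : Precat.{u} (n + 1 : ℕ)} (G : C ⟶ (truncSucc n).obj E)

/-- The action of a prefunctor `C ⟶ E_{≤ n}`, with values in `E`. -/
def rmap (k : Dim n) (x : C.cell k) : E.cell (up (le_succ' n) k) := G.map k x

theorem rmap_bd (ε : Bool) {i k : Dim n} (h : i.1 ≤ k.1) (x : C.cell k) :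
    E.bd ε (up (le_succ' n) i) (rmap G k x) h = rmap G i (C.bd ε i x h) := (G.map_bd ε h x).symm

theorem rmap_idn {k k' : Dim n} (h : k.1 + 1 = k'.1) (x : C.cell k) :
    E.idn (k' := up (le_succ' n) k') h (rmap G k x) = rmap G k' (C.idn h x) := (G.map_idn h x).symm

theorem rmap_composable {i m k l : Dim n} {u : C.cell k} {v : C.cell l}
    (h : C.Composable i m u v) : E.Composable (up (le_succ' n) i) (up (le_succ' n) m)
      (rmap G k u) (rmap G l v) := (G.composable h).ofTrunc

theorem rmap_comp {i m k l : Dim n} (u : C.cell k) (v : C.cell l) (h : C.Composable i m u v) (h') :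
    E.comp (up (le_succ' n) i) (up (le_succ' n) m) (rmap G k u) (rmap G l v) h'
      = rmap G m (C.comp i m u v h) := (G.map_comp u v h).symm

end restr

namespace Gens

variable {C : Precat.{u} n} (X : Gens C)

/-- The inclusion of `C` into `C[X]`. -/
noncomputable def incl : C ⟶ (truncSucc n).obj X.freeExt where
  map k x := ExtCell.old (Dim.le k) x
  map_bd _ _ _ _ _ := rfl
  map_idn {k k'} h x := (Layer.extIdn_old (L := X.freeLayer) (k := up (le_succ' n) k)
    (k' := up (le_succ' n) k') h (Dim.le k) x (Dim.le k')).symm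
  map_comp _ _ _ := rfl

/-- The `(n+1)`-cell of `C[X]` denoted by a formal cell. -/
noncomputable def cellOf {a b : C.cell (top n)} (p : X.Term a b) : X.freeExt.cell (top (n + 1)) :=
  ExtCell.top rfl (Free.mk p)

/-- The inclusion of the generators into the `(n+1)`-cells of `C[X]`. -/
noncomputable def genCell (g : X.gen) : X.freeExt.cell (top (n + 1)) := X.cellOf (.gen g)

theorem bd_cellOf (ε : Bool) {a b : C.cell (top n)} (p : X.Term a b) :
    X.freeExt.bd ε (up (le_succ' n) (top n)) (X.cellOf p) (Nat.le_succ n)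
      = rmap X.incl (top n) (bif ε then b else a) := by
  refine (Layer.extGlob_bd_top_self (L := X.freeLayer) (k := top (n + 1)) (Nat.le_succ n) rfl
    (Free.mk p)).trans ?_
  cases ε <;> rfl

end Gens

section desc

variable {C : Precat.{u} n} {X : Gens C} {E : Precat.{u} (n + 1 : ℕ)}

/-- A prefunctor `C ⟶ E_{≤ n}` together with a compatible assignment of the generators. -/
structure GenMap (X : Gens C) (E : Precat.{u} (n + 1 : ℕ)) where
  base : C ⟶ (truncSucc n).obj E
  gen : X.gen → E.cell (top (n + 1))
  bd_gen : ∀ (ε : Bool) (g : X.gen),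
    E.bd ε (up (le_succ' n) (top n)) (gen g) (Nat.le_succ n) = rmap base (top n) (X.bd ε g)

namespace GenMap

variable (G : GenMap X E)

theorem composable_lw {i k : Dim n} (u : C.cell k) {a : C.cell (top n)}
    (ha : C.Composable i (top n) u a) (e : E.cell (top (n + 1)))
    (he : E.bd false (up (le_succ' n) (top n)) e (Nat.le_succ n) = rmap G.base (top n) a) :
    E.Composable (up (le_succ' n) i) (top (n + 1)) (rmap G.base k u) e := by
  have hi := ha.hi
  have hk := Dim.le k
  dsimp only at hi
  refine ⟨by dsimp only; omega, by dsimp only; omega, ?_⟩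
  have hin : i.1 < n := by omega
  have e1 := ha.eq
  rw [← E.bd_bd false false (i := up (le_succ' n) i) (j := up (le_succ' n) (top n)) hin
    (Nat.le_succ n), he]
  rw [rmap_bd G.base true (i := i) (k := k) (by omega), rmap_bd G.base false (i := i) (k := top n)
    hin.le, e1]

theorem composable_rw {i k : Dim n} (u : C.cell k) {a : C.cell (top n)}
    (ha : C.Composable i (top n) a u) (e : E.cell (top (n + 1)))
    (he : E.bd true (up (le_succ' n) (top n)) e (Nat.le_succ n) = rmap G.base (top n) a) :
    E.Composable (up (le_succ' n) i) (top (n + 1)) e (rmap G.base k u) := by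
  have hi := ha.hi
  have hk := Dim.le k
  dsimp only at hi
  refine ⟨by dsimp only; omega, by dsimp only; omega, ?_⟩
  have hin : i.1 < n := by omega
  have e1 := ha.eq
  rw [← E.bd_bd true true (i := up (le_succ' n) i) (j := up (le_succ' n) (top n)) hin
    (Nat.le_succ n), he]
  rw [rmap_bd G.base false (i := i) (k := k) (by omega), rmap_bd G.base true (i := i) (k := top n)
    hin.le, e1]

theorem bd_lw (ε : Bool) {i k : Dim n} (u : C.cell k) {a : C.cell (top n)}
    (ha : C.Composable i (top n) u a) (e : E.cell (top (n + 1)))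
    (he : E.bd ε (up (le_succ' n) (top n)) e (Nat.le_succ n) = rmap G.base (top n) a)
    (hc : E.Composable (up (le_succ' n) i) (top (n + 1)) (rmap G.base k u) e) :
    E.bd ε (up (le_succ' n) (top n)) (E.comp _ _ (rmap G.base k u) e hc) (Nat.le_succ n)
      = rmap G.base (top n) (C.comp i (top n) u a ha) := by
  have hk : k.1 < n + 1 := Nat.lt_succ_of_le (Dim.le k)
  rw [← rmap_comp G.base u a ha (rmap_composable G.base ha)]
  refine (E.bd_comp_lt ε (j := up (le_succ' n) (top n)) hk rfl _ _ hc
    (hc.bd_right ε rfl hk)).trans ?_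
  simp only [he]

theorem bd_rw (ε : Bool) {i k : Dim n} (u : C.cell k) {a : C.cell (top n)}
    (ha : C.Composable i (top n) a u) (e : E.cell (top (n + 1)))
    (he : E.bd ε (up (le_succ' n) (top n)) e (Nat.le_succ n) = rmap G.base (top n) a)
    (hc : E.Composable (up (le_succ' n) i) (top (n + 1)) e (rmap G.base k u)) :
    E.bd ε (up (le_succ' n) (top n)) (E.comp _ _ e (rmap G.base k u) hc) (Nat.le_succ n)
      = rmap G.base (top n) (C.comp i (top n) a u ha) := by
  have hk : k.1 < n + 1 := Nat.lt_succ_of_le (Dim.le k)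
  rw [← rmap_comp G.base a u ha (rmap_composable G.base ha)]
  refine (E.bd_comp_gt ε (j := up (le_succ' n) (top n)) hk rfl _ _ hc
    (hc.bd_left ε rfl hk)).trans ?_
  simp only [he]

theorem composable_comp {b : C.cell (top n)} (e e' : E.cell (top (n + 1)))
    (he : E.bd true (up (le_succ' n) (top n)) e (Nat.le_succ n) = rmap G.base (top n) b)
    (he' : E.bd false (up (le_succ' n) (top n)) e' (Nat.le_succ n) = rmap G.base (top n) b) :
    E.Composable (up (le_succ' n) (top n)) (top (n + 1)) e e' :=
  ⟨by simp, by simp, he.trans he'.symm⟩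

/-- The interpretation of formal cells. -/
def eval {a b : C.cell (top n)} : X.Term a b → {e : E.cell (top (n + 1)) //
    E.bd false (up (le_succ' n) (top n)) e (Nat.le_succ n) = rmap G.base (top n) a ∧
    E.bd true (up (le_succ' n) (top n)) e (Nat.le_succ n) = rmap G.base (top n) b}
  | .gen g => ⟨G.gen g, G.bd_gen false g, G.bd_gen true g⟩
  | .idn c => ⟨E.idn (k' := top (n + 1)) rfl (rmap G.base (top n) c),
      E.bd_idn false (k' := top (n + 1)) rfl _, E.bd_idn true (k' := top (n + 1)) rfl _⟩
  | .comp h p q => ⟨E.comp _ _ (eval p).1 (eval q).1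
      (G.composable_comp _ _ (eval p).2.2 (by rw [h]; exact (eval q).2.1)),
      (E.src_comp (k := top (n + 1)) rfl _ _ _).trans (eval p).2.1,
      (E.tgt_comp (k := top (n + 1)) rfl _ _ _).trans (eval q).2.2⟩
  | .lw u ha hb p => ⟨E.comp _ _ (rmap G.base _ u) (eval p).1
      (G.composable_lw u ha _ (eval p).2.1), G.bd_lw false u ha _ (eval p).2.1 _,
      G.bd_lw true u hb _ (eval p).2.2 _⟩
  | .rw u ha hb p => ⟨E.comp _ _ (eval p).1 (rmap G.base _ u)
      (G.composable_rw u hb _ (eval p).2.2), G.bd_rw false u ha _ (eval p).2.1 _,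
      G.bd_rw true u hb _ (eval p).2.2 _⟩

theorem comp_congr {m : ℕ∞} (E : Precat.{u} m) {i r k l : Dim m} {u u' : E.cell k} {v v' : E.cell l}
    (hu : u = u') (hv : v = v') (h h') : E.comp i r u v h = E.comp i r u' v' h' := by
  subst hu hv; rfl

theorem eval_rel {a b a' b' : C.cell (top n)} {p : X.Term a b} {q : X.Term a' b'}
    (h : Gens.Rel p q) : (G.eval p).1 = (G.eval q).1 := by
  induction h with
  | refl p => rfl
  | symm _ h => exact h.symm
  | trans _ _ h h' => exact h.trans h'
  | comp_congr _ _ h h' => exact comp_congr E h h' _ _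
  | lw_congr _ h => exact comp_congr E rfl h _ _
  | rw_congr _ h => exact comp_congr E h rfl _ _
  | idn_comp h p => exact E.idn_comp _ le_rfl _ _ _
  | comp_idn h p => exact E.comp_idn _ le_rfl _ _ _
  | assoc p q r => exact E.assoc _ _ _ _ _ _ _
  | @lw_idn i k u c h =>
    have hk : k.1 < n + 1 := Nat.lt_succ_of_le (Dim.le k)
    refine (E.comp_idn' (l' := top (n + 1)) rfl hk _ _ _ (rmap_composable G.base h)).trans ?_
    rw [rmap_comp G.base u c h]; rfl
  | @rw_idn i k u c h =>
    have hk : k.1 < n + 1 := Nat.lt_succ_of_le (Dim.le k)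
    refine (E.idn_comp' (k' := top (n + 1)) rfl hk _ _ _ (rmap_composable G.base h)).trans ?_
    rw [rmap_comp G.base c u h]; rfl
  | @idn_lw i k hi x a b p ha hb =>
    have hk : k.1 ≤ n + 1 := Nat.le_succ_of_le (Dim.le k)
    exact (comp_congr E (rmap_idn G.base hi x).symm rfl _ (by
      rw [rmap_idn]; exact (G.composable_lw _ ha _ (G.eval p).2.1))).trans
      (E.idn_comp _ hk _ _ _)
  | @rw_of_idn i k hi x a b p ha hb =>
    have hk : k.1 ≤ n + 1 := Nat.le_succ_of_le (Dim.le k)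
    exact (comp_congr E rfl (rmap_idn G.base hi x).symm _ (by
      rw [rmap_idn]; exact (G.composable_rw _ hb _ (G.eval p).2.2))).trans
      (E.comp_idn _ hk _ _ _)
  | lw_lw u v p h₁ =>
    refine (comp_congr E (rmap_comp G.base u v h₁ (rmap_composable G.base h₁)).symm rfl _
      ?_).trans (E.assoc _ _ _ _ _ _ _)
    rw [rmap_comp G.base u v h₁]
    exact G.composable_lw _ ‹_› _ (G.eval p).2.1
  | lw_rw => exact E.assoc _ _ _ _ _ _ _
  | rw_rw u v p _ _ _ _ h₃ h₄ h₄' =>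
    refine .trans (E.assoc _ _ _ _ _ (rmap_composable G.base h₃) ?_)
      (comp_congr E rfl (rmap_comp G.base u v h₃ (rmap_composable G.base h₃)) _ _)
    rw [rmap_comp G.base u v h₃]
    exact G.composable_rw _ h₄' _ (G.eval p).2.2
  | @lw_comp i k u _ _ _ _ h p q h₂ =>
    have hk : k.1 ≤ n := Dim.le k
    have hi := h₂.hi
    exact E.distrib_left (j := up (le_succ' n) (top n)) (by dsimp only at hi ⊢; omega)
      _ _ _ _ _ _ _ _
  | @rw_comp i k u _ _ _ _ h p q h₂ =>
    have hk : k.1 ≤ n := Dim.le k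
    have hi := h₂.hi
    exact E.distrib_right (j := up (le_succ' n) (top n)) (by dsimp only at hi ⊢; omega)
      _ _ _ _ _ _ _ _
  | lw_distrib_lw hij u v p h₁ h₁' h₂ h₂' h₃ h₄ h₄' h₅ h₅' =>
    refine .trans (E.distrib_left hij _ _ _ _ _ (rmap_composable G.base h₃) ?_ ?_)
      (comp_congr E (rmap_comp G.base _ _ h₃ (rmap_composable G.base h₃)) rfl _ _)
    · exact G.composable_lw _ h₄ _ (G.eval p).2.1
    · rw [rmap_comp G.base _ _ h₃]
      exact G.composable_lw _ h₅ _ (G.eval (.lw _ h₄ h₄' p)).2.1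
  | lw_distrib_rw hij u v p h₁ h₁' h₂ h₂' h₃ h₄ h₄' h₅ h₅' =>
    refine .trans (E.distrib_left hij _ _ _ _ _ ?_ (rmap_composable G.base h₃) ?_)
      (comp_congr E rfl (rmap_comp G.base _ _ h₃ (rmap_composable G.base h₃)) _ _)
    · exact G.composable_lw _ h₄ _ (G.eval p).2.1
    · rw [rmap_comp G.base _ _ h₃]
      exact G.composable_rw _ h₅' _ (G.eval (.lw _ h₄ h₄' p)).2.2
  | rw_distrib_lw hij u v p h₁ h₁' h₂ h₂' h₃ h₄ h₄' h₅ h₅' =>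
    refine .trans (E.distrib_right hij _ _ _ _ _ (rmap_composable G.base h₃) ?_ ?_)
      (comp_congr E (rmap_comp G.base _ _ h₃ (rmap_composable G.base h₃)) rfl _ _)
    · exact G.composable_rw _ h₄' _ (G.eval p).2.2
    · rw [rmap_comp G.base _ _ h₃]
      exact G.composable_lw _ h₅ _ (G.eval (.rw _ h₄ h₄' p)).2.1
  | rw_distrib_rw hij u v p h₁ h₁' h₂ h₂' h₃ h₄ h₄' h₅ h₅' =>
    refine .trans (E.distrib_right hij _ _ _ _ _ ?_ (rmap_composable G.base h₃) ?_)
      (comp_congr E rfl (rmap_comp G.base _ _ h₃ (rmap_composable G.base h₃)) _ _)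
    · exact G.composable_rw _ h₄' _ (G.eval p).2.2
    · rw [rmap_comp G.base _ _ h₃]
      exact G.composable_rw _ h₅' _ (G.eval (.rw _ h₄ h₄' p)).2.2

/-- The interpretation of free cells. -/
def evalFree (p : Gens.Free X) : E.cell (top (n + 1)) :=
  p.lift (fun p => (G.eval p.term).1) fun _ _ h => G.eval_rel h

theorem bd_evalFree (ε : Bool) (p : Gens.Free X) :
    E.bd ε (up (le_succ' n) (top n)) (G.evalFree p) (Nat.le_succ n)
      = rmap G.base (top n) (p.bd ε) := by
  induction p using Gens.Free.ind with | h p => ?_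
  cases ε
  exacts [(G.eval p).2.1, (G.eval p).2.2]

/-- The action on cells of the prefunctor `C[X] ⟶ E` induced by `G`. -/
def liftMap (k : Dim (n + 1 : ℕ)) : X.freeExt.cell k → E.cell k
  | .old hk c => rmap G.base ⟨k.1, Nat.cast_le.mpr hk⟩ c
  | .top hk p => E.bd true k (G.evalFree p) hk.le

theorem liftMap_top (p : Gens.Free X) (h) : G.liftMap (top (n + 1)) (.top h p) = G.evalFree p :=
  E.bd_self true _

theorem liftMap_old (k : Dim (n + 1 : ℕ)) (hk) (c) :
    G.liftMap k (.old hk c) = rmap G.base ⟨k.1, Nat.cast_le.mpr hk⟩ c := rfl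

theorem evalFree_comp (p q : Gens.Free X) (h) (h') :
    G.evalFree (p.comp q h) = E.comp (up (le_succ' n) (top n)) (top (n + 1)) (G.evalFree p)
      (G.evalFree q) h' := by
  induction p using Gens.Free.ind with | h p => ?_
  induction q using Gens.Free.ind with | h q => ?_
  rw [Gens.Free.comp_mk]; rfl

theorem evalFree_lw {i k : Dim n} (u : C.cell k) (p : Gens.Free X) (h) (h') :
    G.evalFree (p.lw (i := i) u h) = E.comp (up (le_succ' n) i) (top (n + 1)) (rmap G.base k u)
      (G.evalFree p) h' := by
  induction p using Gens.Free.ind with | h p => ?_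
  rw [Gens.Free.lw_mk]; rfl

theorem evalFree_rw {i k : Dim n} (u : C.cell k) (p : Gens.Free X) (h) (h') :
    G.evalFree (p.rw (i := i) u h) = E.comp (up (le_succ' n) i) (top (n + 1)) (G.evalFree p)
      (rmap G.base k u) h' := by
  induction p using Gens.Free.ind with | h p => ?_
  rw [Gens.Free.rw_mk]; rfl

theorem liftMap_bd (ε : Bool) {i k : Dim (n + 1 : ℕ)} (h : i.1 ≤ k.1) (x : X.freeExt.cell k) :
    G.liftMap i (X.freeExt.bd ε i x h) = E.bd ε i (G.liftMap k x) h := by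
  rcases x with ⟨hk, c⟩ | ⟨hk, p⟩
  · exact (rmap_bd G.base ε (i := ⟨i.1, _⟩) (k := ⟨k.1, _⟩) h c).symm
  · obtain ⟨k, hk'⟩ := k
    dsimp only at hk
    subst hk
    by_cases hi : i.1 ≤ n
    · refine (congrArg (G.liftMap i) (Layer.extGlob_bd_top (L := X.freeLayer) h rfl p hi)).trans ?_
      refine (rmap_bd G.base ε (i := ⟨i.1, Nat.cast_le.mpr hi⟩) (k := top n) hi _).symm.trans ?_
      refine (congrArg (fun z => E.bd ε i z hi) (G.bd_evalFree ε p)).symm.trans ?_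
      refine (E.bd_bd_same ε hi (Nat.le_succ n) _).trans ?_
      exact congrArg (fun z => E.bd ε i z h) (G.liftMap_top p rfl).symm
    · have hi' := Dim.le i
      obtain ⟨i, _⟩ := i
      obtain rfl : i = n + 1 := by dsimp only at hi hi'; omega
      exact (congrArg (G.liftMap _) (X.freeExt.bd_self ε _)).trans (E.bd_self ε _).symm

theorem liftMap_composable {i m k l : Dim (n + 1 : ℕ)} {u : X.freeExt.cell k}
    {v : X.freeExt.cell l} (h : X.freeExt.Composable i m u v) :
    E.Composable i m (G.liftMap k u) (G.liftMap l v) :=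
  ⟨h.hi, h.hm, by rw [← G.liftMap_bd, ← G.liftMap_bd, h.eq]⟩

/-- The prefunctor `C[X] ⟶ E` induced by `G`. -/
def lift : X.freeExt ⟶ E where
  map := G.liftMap
  map_bd := G.liftMap_bd
  map_idn {k k'} h x := by
    rcases x with ⟨hk, c⟩ | ⟨hk, p⟩
    · by_cases hk' : k'.1 ≤ n
      · exact (congrArg (G.liftMap k') (Layer.extIdn_old (L := X.freeLayer) h hk c hk')).trans
          (rmap_idn G.base (k' := ⟨k'.1, Nat.cast_le.mpr hk'⟩) h c).symm
      · obtain ⟨k, _⟩ := k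
        obtain ⟨k', hk''⟩ := k'
        have h1 : k' ≤ n + 1 := Nat.cast_le.mp hk''
        dsimp only at h hk hk'
        obtain rfl : k = n := by omega
        subst h
        exact (congrArg (G.liftMap _) (Layer.extIdn_top (L := X.freeLayer) (hk := hk) c)).trans
          (G.liftMap_top _ _)
    · have := Dim.le k'; omega
  map_comp {i m k l} u v h := by
    have hi := h.hi
    have hm := h.hm
    have hk' := Dim.le k
    have hl' := Dim.le l
    have h' := G.liftMap_composable h
    obtain ⟨k, _⟩ := k
    obtain ⟨l, _⟩ := l
    obtain ⟨m, _⟩ := m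
    obtain ⟨i, _⟩ := i
    dsimp only at hi hm hk' hl'
    rcases u with ⟨hk, u⟩ | ⟨hk, u⟩ <;> rcases v with ⟨hl, v⟩ | ⟨hl, v⟩ <;> dsimp only at hk hl
    · exact (rmap_comp G.base _ _ (Layer.comp_old_old h) h').symm
    · obtain rfl : m = n + 1 := by omega
      subst hl
      refine (G.liftMap_top _ _).trans ((G.evalFree_lw u v (Layer.comp_old_top h) ?_).trans
        (comp_congr E rfl (G.liftMap_top v rfl).symm _ h'))
      rw [← G.liftMap_top v rfl]; exact h'
    · obtain rfl : m = n + 1 := by omega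
      subst hk
      refine (G.liftMap_top _ _).trans ((G.evalFree_rw v u (Layer.comp_top_old h) ?_).trans
        (comp_congr E (G.liftMap_top u rfl).symm rfl _ h'))
      rw [← G.liftMap_top u rfl]; exact h'
    · obtain rfl : m = n + 1 := by omega
      obtain rfl : i = n := by omega
      subst hk hl
      refine (G.liftMap_top _ _).trans ((G.evalFree_comp u v (Layer.comp_top_top h) ?_).trans
        (comp_congr E (G.liftMap_top u rfl).symm (G.liftMap_top v rfl).symm _ h'))
      rw [← G.liftMap_top v rfl, ← G.liftMap_top u rfl]; exact h'

theorem lift_incl : X.incl ≫ (truncSucc n).map G.lift = G.base := by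
  ext k x; rfl

theorem lift_gen (g : X.gen) : G.lift.map (top (n + 1)) (X.genCell g) = G.gen g :=
  G.liftMap_top (Gens.Free.mk (.gen g)) rfl

end GenMap

/-- The inclusions of `C` and of the generators in `C[X]`. -/
noncomputable def univ (X : Gens C) : GenMap X X.freeExt where
  base := X.incl
  gen := X.genCell
  bd_gen ε g := by rw [Gens.genCell, X.bd_cellOf ε]; cases ε <;> rfl

namespace Gens

theorem cellOf_idn (c : C.cell (top n)) : X.cellOf (.idn c)
    = X.freeExt.idn (k := up (le_succ' n) (top n)) (k' := top (n + 1)) rfl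
      (rmap X.incl (top n) c) :=
  (Layer.extIdn_top (L := X.freeLayer) (hk := le_rfl) c).symm

theorem cellOf_comp {a b b' c : C.cell (top n)} (h : b = b') (p : X.Term a b) (q : X.Term b' c) :
    ∃ h', X.cellOf (.comp h p q) = X.freeExt.comp (up (le_succ' n) (top n)) (top (n + 1))
      (X.cellOf p) (X.cellOf q) h' :=
  ⟨(univ X).composable_comp (b := b) _ _ (X.bd_cellOf true p) (h ▸ X.bd_cellOf false q),
    congrArg (ExtCell.top rfl) (Free.comp_mk p q h).symm⟩

theorem cellOf_lw {i k : Dim n} (u : C.cell k) {a b : C.cell (top n)} (ha) (hb) (p : X.Term a b) :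
    ∃ h', X.cellOf (.lw (i := i) u ha hb p) = X.freeExt.comp (up (le_succ' n) i) (top (n + 1))
      (rmap X.incl k u) (X.cellOf p) h' :=
  ⟨(univ X).composable_lw u ha _ (X.bd_cellOf false p),
    congrArg (ExtCell.top rfl) (Free.lw_mk (i := i) u p (fun ε => by cases ε; exacts [ha, hb])).symm⟩

theorem cellOf_rw {i k : Dim n} (u : C.cell k) {a b : C.cell (top n)} (ha) (hb) (p : X.Term a b) :
    ∃ h', X.cellOf (.rw (i := i) u ha hb p) = X.freeExt.comp (up (le_succ' n) i) (top (n + 1))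
      (X.cellOf p) (rmap X.incl k u) h' :=
  ⟨(univ X).composable_rw u hb _ (X.bd_cellOf true p),
    congrArg (ExtCell.top rfl) (Free.rw_mk (i := i) u p (fun ε => by cases ε; exacts [ha, hb])).symm⟩

end Gens

/-- Prefunctors from `C[X]` are determined by their restrictions to `C` and to the generators. -/
theorem freeExt_hom_ext {F G : X.freeExt ⟶ E}
    (h : X.incl ≫ (truncSucc n).map F = X.incl ≫ (truncSucc n).map G)
    (hg : ∀ g, F.map (top (n + 1)) (X.genCell g) = G.map (top (n + 1)) (X.genCell g)) : F = G := by
  have h₀ : ∀ (k : Dim n) (c : C.cell k), F.map (up (le_succ' n) k) (rmap X.incl k c)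
      = G.map (up (le_succ' n) k) (rmap X.incl k c) := fun k c => by
    have := congrArg (fun H : C ⟶ (truncSucc n).obj E => H.map k c) h
    exact this
  have h₁ : ∀ {a b : C.cell (top n)} (p : X.Term a b), F.map (top (n + 1))
      (X.cellOf p) = G.map (top (n + 1)) (X.cellOf p) := by
    intro a b p
    induction p with
    | gen g => exact hg g
    | idn c => rw [Gens.cellOf_idn, F.map_idn, G.map_idn, h₀]
    | comp h p q hp hq =>
      obtain ⟨h', e⟩ := Gens.cellOf_comp h p q
      rw [e, F.map_comp, G.map_comp]
      exact GenMap.comp_congr E hp hq _ _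
    | lw u ha hb p hp =>
      obtain ⟨h', e⟩ := Gens.cellOf_lw u ha hb p
      rw [e, F.map_comp, G.map_comp]
      exact GenMap.comp_congr E (h₀ _ u) hp _ _
    | rw u ha hb p hp =>
      obtain ⟨h', e⟩ := Gens.cellOf_rw u ha hb p
      rw [e, F.map_comp, G.map_comp]
      exact GenMap.comp_congr E hp (h₀ _ u) _ _
  ext k x
  rcases x with ⟨hk, c⟩ | ⟨hk, p⟩
  · exact h₀ ⟨k.1, Nat.cast_le.mpr hk⟩ c
  · obtain ⟨k, _⟩ := k
    dsimp only at hk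
    subst hk
    induction p using Gens.Free.ind with | h p => exact h₁ p

end desc

end Precat

namespace Precat

/-- Cellular extensions: for `F : A ⥤ PCat n`, the pullback of `F` (followed by the forgetful functor
to `n`-globular sets) along the truncation functor from `(n+1)`-globular sets to `n`-globular sets.
An object is an object of `A` with a set of `(n+1)`-generators over its image under `F`. -/
structure CellExt {n : ℕ} {A : Type (u + 1)} [Category.{u} A] (F : A ⥤ Precat.{u} n) where
  base : A
  gens : Gens (F.obj base)

namespace CellExt

variable {n : ℕ} {A : Type (u + 1)} [Category.{u} A] {F : A ⥤ Precat.{u} n}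

/-- Morphisms of cellular extensions. -/
@[ext]
structure Hom (P Q : CellExt F) where
  base : P.base ⟶ Q.base
  gen : P.gens.gen → Q.gens.gen
  bd_gen : ∀ (ε : Bool) (g : P.gens.gen),
    Q.gens.bd ε (gen g) = (F.map base).map (top n) (P.gens.bd ε g)

instance : Category.{u} (CellExt F) where
  Hom := Hom
  id P := { base := 𝟙 _, gen := fun g => g, bd_gen := fun ε g => by rw [F.map_id]; rfl }
  comp f g :=
    { base := f.base ≫ g.base
      gen := fun x => g.gen (f.gen x)
      bd_gen := fun ε x => by rw [g.bd_gen, f.bd_gen, F.map_comp]; rfl }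
  id_comp f := Hom.ext (Category.id_comp _) rfl
  comp_id f := Hom.ext (Category.comp_id _) rfl
  assoc f g h := Hom.ext (Category.assoc _ _ _) rfl

variable (F)

/-- The functor which forgets the `(n+1)`-generators. -/
def forget : CellExt F ⥤ A where
  obj P := P.base
  map f := f.base

/-- The set of `(n+1)`-generators. -/
def topGen : CellExt F ⥤ Type u where
  obj P := P.gens.gen
  map f := TypeCat.ofHom f.gen

/-- The data defining the prefunctor induced by a morphism of cellular extensions. -/
noncomputable def genMap {P Q : CellExt F} (f : P ⟶ Q) : GenMap P.gens Q.gens.freeExt where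
  base := F.map f.base ≫ Q.gens.incl
  gen g := Q.gens.genCell (f.gen g)
  bd_gen ε g := ((univ Q.gens).bd_gen ε (f.gen g)).trans
    (congrArg (rmap Q.gens.incl (top n)) (f.bd_gen ε g))

/-- The free `(n+1)`-precategory on a cellular extension. -/
noncomputable def free : CellExt F ⥤ Precat.{u} (n + 1 : ℕ) where
  obj P := P.gens.freeExt
  map f := (genMap F f).lift
  map_id P := by
    refine freeExt_hom_ext ?_ fun g => ?_
    · rw [GenMap.lift_incl, CategoryTheory.Functor.map_id, Category.comp_id]
      exact (congrArg (· ≫ P.gens.incl) (F.map_id P.base)).trans (Category.id_comp _)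
    · rw [GenMap.lift_gen]; rfl
  map_comp {P Q R} f g := by
    refine freeExt_hom_ext ?_ fun x => ?_
    · rw [GenMap.lift_incl, Functor.map_comp, ← Category.assoc, GenMap.lift_incl]
      change F.map (f.base ≫ g.base) ≫ _ = (F.map f.base ≫ _) ≫ _
      rw [F.map_comp, Category.assoc, Category.assoc, GenMap.lift_incl]
      rfl
    · rw [GenMap.lift_gen]
      exact (((genMap F g).lift_gen _).symm.trans
        (congrArg _ ((genMap F f).lift_gen x).symm))

end CellExt

/-- The functor sending a set to the corresponding `0`-precategory (in which no identity and no
composition are to be defined, so that the values given for them below are irrelevant). -/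
def disc : Type u ⥤ Precat.{u} (0 : ℕ) where
  obj A :=
    { cell := fun _ => A
      bd := fun _ _ _ x _ => x
      bd_self := fun _ _ _ => rfl
      bd_bd := fun _ _ _ _ _ _ _ _ => rfl
      idn := fun _ x => x
      comp := fun _ _ _ _ u _ _ => u
      bd_idn := fun _ _ _ _ _ => rfl
      bd_comp_lt := fun _ _ _ _ _ _ _ _ _ _ _ => rfl
      bd_comp_gt := fun _ _ _ _ _ _ _ _ _ _ _ => rfl
      src_comp := fun _ _ _ _ => rfl
      tgt_comp := fun _ _ _ h => h.eq
      idn_comp := fun _ _ _ _ h => h.eq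
      idn_comp' := fun _ _ _ _ _ _ => rfl
      comp_idn := fun _ _ _ _ _ => rfl
      comp_idn' := fun _ _ _ _ _ _ => rfl
      assoc := fun _ _ _ _ _ _ _ => rfl
      distrib_left := fun _ _ _ _ _ _ _ _ _ => rfl
      distrib_right := fun _ _ _ _ _ _ _ _ _ => rfl }
  map f := { map := fun _ x => f x
             map_bd := fun _ _ _ _ _ => rfl
             map_idn := fun _ _ => rfl
             map_comp := fun _ _ _ => rfl }

end Precat

/-- `n`-polygraphs, defined by induction on `n` together with the free `n`-precategory functor. -/
structure PolData (n : ℕ) where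
  Obj : Type (u + 1)
  [cat : Category.{u} Obj]
  free : Obj ⥤ Precat.{u} n

attribute [instance] PolData.cat

/-- A `0`-polygraph is a set; an `(n+1)`-polygraph is an `n`-polygraph `P` with a set of
`(n+1)`-generators over `P*`. -/
noncomputable def polData : ∀ n : ℕ, PolData.{u} n
  | 0 => ⟨Type u, Precat.disc⟩
  | n + 1 => ⟨Precat.CellExt (polData n).free, Precat.CellExt.free (polData n).free⟩

/-- The category of `n`-polygraphs, for `n ∈ ℕ`. -/
def Pol (n : ℕ) : Type (u + 1) := (polData.{u} n).Obj

noncomputable instance (n : ℕ) : Category.{u} (Pol.{u} n) := (polData.{u} n).cat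

namespace Pol

/-- The functor `P ↦ P*` from `n`-polygraphs to `n`-precategories. -/
noncomputable def free (n : ℕ) : Pol.{u} n ⥤ Precat.{u} n := (polData.{u} n).free

/-- The truncation functor. -/
noncomputable def trunc (n : ℕ) : Pol.{u} (n + 1) ⥤ Pol.{u} n :=
  Precat.CellExt.forget (polData.{u} n).free

/-- The functor `P ↦ P_k` of `k`-generators. -/
noncomputable def gen : ∀ (n k : ℕ), k ≤ n → (Pol.{u} n ⥤ Type u)
  | 0, _, _ => 𝟭 (Type u)
  | n + 1, k, h =>
    if hk : k ≤ n then trunc n ⋙ gen n k hk else Precat.CellExt.topGen (polData.{u} n).free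

/-- The canonical isomorphism between the free precategory on the truncation of a polygraph and the
truncation of the free precategory. -/
noncomputable def freeTrunc (n : ℕ) (P : Pol.{u} (n + 1)) :
    (free n).obj ((trunc n).obj P) ⟶ (Precat.truncSucc n).obj ((free (n + 1)).obj P) :=
  (Precat.CellExt.gens (F := (polData.{u} n).free) P).incl

end Pol

/-- The category of `ω`-polygraphs: the limit of the categories of `n`-polygraphs along the
truncation functors. -/
structure OmegaPol where
  obj : ∀ n : ℕ, Pol.{u} n
  trunc_obj : ∀ n, (Pol.trunc n).obj (obj (n + 1)) = obj n

namespace OmegaPol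

/-- Morphisms of `ω`-polygraphs. -/
@[ext]
structure Hom (P Q : OmegaPol.{u}) where
  map : ∀ n : ℕ, P.obj n ⟶ Q.obj n
  trunc_map : ∀ n, (Pol.trunc n).map (map (n + 1)) ≫ eqToHom (Q.trunc_obj n)
    = eqToHom (P.trunc_obj n) ≫ map n

noncomputable instance : Category.{u} OmegaPol.{u} where
  Hom := Hom
  id P := { map := fun n => 𝟙 _, trunc_map := fun n => by simp }
  comp F G :=
    { map := fun n => F.map n ≫ G.map n
      trunc_map := fun n => by
        rw [Functor.map_comp, Category.assoc, G.trunc_map, ← Category.assoc, F.trunc_map,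
          Category.assoc] }
  id_comp F := Hom.ext (funext fun n => Category.id_comp _)
  comp_id F := Hom.ext (funext fun n => Category.comp_id _)
  assoc F G H := Hom.ext (funext fun n => Category.assoc _ _ _)

/-- The functor sending an `ω`-polygraph to its underlying `n`-polygraph. -/
noncomputable def toPol (n : ℕ) : OmegaPol.{u} ⥤ Pol.{u} n where
  obj P := P.obj n
  map F := F.map n

/-- The functor `P ↦ P_k` of `k`-generators. -/
noncomputable def gen (k : ℕ) : OmegaPol.{u} ⥤ Type u := toPol k ⋙ Pol.gen k k le_rfl

end OmegaPol

namespace Precat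

theorem natLe {a b : ℕ} (h : a ≤ b) : (a : ℕ∞) ≤ b := Nat.cast_le.mpr h

/-- A sequence of `n`-precategories `C n`, where `C n` is the `n`-truncation of `C (n+1)` up to
isomorphism. -/
structure Tower where
  C : ∀ n : ℕ, Precat.{u} n
  φ : ∀ n, C n ⟶ (truncSucc n).obj (C (n + 1))
  bij : ∀ n k, Function.Bijective ((φ n).map k)

namespace Tower

variable (T : Tower.{u})

/-- The inclusions of `C a` into `C b` for `a ≤ b`. -/
noncomputable def t {a : ℕ} (b : ℕ) (h : a ≤ b) : T.C a ⟶ (trunc (natLe h)).obj (T.C b) :=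
  Nat.leRec (motive := fun b h => T.C a ⟶ (trunc (natLe h)).obj (T.C b))
    (𝟙 (T.C a)) (fun b h f => f ≫ (trunc (natLe h)).map (T.φ b)) h

theorem t_self (a : ℕ) : T.t a le_rfl = 𝟙 (T.C a) := Nat.leRec_self _ _

theorem t_succ {a : ℕ} (b : ℕ) (h : a ≤ b) :
    T.t (b + 1) (h.trans b.le_succ) = T.t b h ≫ (trunc (natLe h)).map (T.φ b) :=
  Nat.leRec_succ _ _ h

/-- The map from `k`-cells of `C a` to `k`-cells of `C b`. -/
noncomputable def r {a b : ℕ} (h : a ≤ b) (k : ℕ) (hk : k ≤ a) (x : (T.C a).cell ⟨k, natLe hk⟩) :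
    (T.C b).cell ⟨k, natLe (hk.trans h)⟩ := (T.t b h).map ⟨k, natLe hk⟩ x

theorem r_self {a : ℕ} (k : ℕ) (hk : k ≤ a) (x) : T.r (le_refl a) k hk x = x := by
  rw [r, t_self]; rfl

theorem r_succ {a b : ℕ} (h : a ≤ b) (k : ℕ) (hk : k ≤ a) (x) :
    T.r (h.trans b.le_succ) k hk x = (T.φ b).map ⟨k, natLe (hk.trans h)⟩ (T.r h k hk x) := by
  rw [r, t_succ]; rfl

theorem r_trans {a b c : ℕ} (h : a ≤ b) (h' : b ≤ c) (k : ℕ) (hk : k ≤ a) (x) :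
    T.r h' k (hk.trans h) (T.r h k hk x) = T.r (h.trans h') k hk x := by
  induction c, h' using Nat.le_induction with
  | base => rw [r_self]
  | succ c hc ih => rw [T.r_succ hc, ih, ← T.r_succ]

theorem r_bij {a b : ℕ} (h : a ≤ b) (k : ℕ) (hk : k ≤ a) : Function.Bijective (T.r h k hk) := by
  induction b, h using Nat.le_induction with
  | base => convert Function.bijective_id using 1; funext x; exact T.r_self k hk x
  | succ b hb ih =>
    have := (T.bij b ⟨k, natLe (hk.trans hb)⟩).comp ih
    have e : T.r (hb.trans b.le_succ) k hk = (T.φ b).map ⟨k, natLe (hk.trans hb)⟩ ∘ T.r hb k hk :=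
      funext fun x => T.r_succ hb k hk x
    rw [e]
    exact this

/-- The `k`-cells of the limit. -/
abbrev Cell (k : Dim ⊤) : Type u := (T.C k.1).cell (top k.1)

/-- The `k`-cells of the limit are the `k`-cells of `C b` for any `b ≥ k`. -/
noncomputable def e (b : ℕ) (k : Dim ⊤) (h : k.1 ≤ b) : T.Cell k ≃ (T.C b).cell ⟨k.1, natLe h⟩ :=
  Equiv.ofBijective (T.r h k.1 le_rfl) (T.r_bij h k.1 le_rfl)

theorem e_symm {b c : ℕ} (i : Dim ⊤) (hi : i.1 ≤ b) (h : b ≤ c) (y : (T.C b).cell ⟨i.1, natLe hi⟩) :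
    T.e c i (hi.trans h) ((T.e b i hi).symm y) = T.r h i.1 hi y := by
  obtain ⟨x, rfl⟩ := (T.e b i hi).surjective y
  rw [Equiv.symm_apply_apply]
  exact (T.r_trans hi h i.1 le_rfl x).symm

theorem r_bd {a b : ℕ} (h : a ≤ b) (ε : Bool) {i k : ℕ} (hik : i ≤ k) (hk : k ≤ a)
    (x : (T.C a).cell ⟨k, natLe hk⟩) :
    T.r h i (hik.trans hk) ((T.C a).bd ε ⟨i, natLe (hik.trans hk)⟩ x hik)
      = (T.C b).bd ε ⟨i, natLe (hik.trans (hk.trans h))⟩ (T.r h k hk x) hik :=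
  (T.t b h).map_bd ε (i := ⟨i, _⟩) (k := ⟨k, _⟩) hik x

/-- Sources and targets in the limit. -/
noncomputable def limBd (ε : Bool) (i : Dim ⊤) {k : Dim ⊤} (x : T.Cell k) (h : i.1 ≤ k.1) :
    T.Cell i := (T.e k.1 i h).symm ((T.C k.1).bd ε ⟨i.1, natLe h⟩ x h)

theorem e_bd (b : ℕ) (ε : Bool) {i k : Dim ⊤} (h : i.1 ≤ k.1) (hk : k.1 ≤ b) (x : T.Cell k) :
    T.e b i (h.trans hk) (T.limBd ε i x h) = (T.C b).bd ε ⟨i.1, natLe (h.trans hk)⟩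
      (T.e b k hk x) h := by
  rw [limBd, T.e_symm i h hk]
  exact T.r_bd hk ε h le_rfl x

/-- The underlying globular set of the limit. -/
noncomputable abbrev glob : GlobularSet.{u} ⊤ where
  cell k := T.Cell k
  bd ε i {_} x h := T.limBd ε i x h
  bd_self ε k x := (T.e k.1 k le_rfl).injective (by
    rw [e_bd, (T.C k.1).bd_self ε])
  bd_bd ε η i j k hij hjk x := (T.e k.1 i (hij.le.trans hjk)).injective (by
    rw [T.e_bd k.1 ε hij.le hjk, T.e_bd k.1 η hjk le_rfl, T.e_bd k.1 ε (hij.le.trans hjk) le_rfl]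
    exact (T.C k.1).bd_bd ε η (i := ⟨i.1, _⟩) (j := ⟨j.1, _⟩) (k := ⟨k.1, _⟩) hij hjk _)

variable {T} in
theorem composable {b : ℕ} {i m k l : Dim ⊤} {u : T.Cell k} {v : T.Cell l}
    (h : T.glob.Composable i m u v) (hm : m.1 ≤ b) :
    (T.C b).Composable ⟨i.1, natLe (by have := h.hi; have := h.hm; omega)⟩ ⟨m.1, natLe hm⟩
      (T.e b k (by have := h.hm; omega) u) (T.e b l (by have := h.hm; omega) v) := by
  have hi := h.hi
  have hm' := h.hm
  refine ⟨hi, hm', ?_⟩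
  have := congrArg (T.e b i (by omega)) h.eq
  rwa [T.e_bd b true (by omega) (by omega), T.e_bd b false (by omega) (by omega)] at this

/-- Identities in the limit. -/
noncomputable def limIdn {k k' : Dim ⊤} (h : k.1 + 1 = k'.1) (x : T.Cell k) : T.Cell k' :=
  (T.C k'.1).idn (k' := top k'.1) h (T.e k'.1 k (by omega) x)

/-- Compositions in the limit. -/
noncomputable def limComp (i m : Dim ⊤) {k l : Dim ⊤} (u : T.Cell k) (v : T.Cell l)
    (h : T.glob.Composable i m u v) : T.Cell m :=
  (T.C m.1).comp _ (top m.1) _ _ (composable h le_rfl)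

theorem e_e {b c : ℕ} (k : Dim ⊤) (h : k.1 ≤ b) (h' : b ≤ c) (x : T.Cell k) :
    T.r h' k.1 h (T.e b k h x) = T.e c k (h.trans h') x := T.r_trans h h' k.1 le_rfl x

theorem e_idn (b : ℕ) {k k' : Dim ⊤} (h : k.1 + 1 = k'.1) (hk : k'.1 ≤ b) (x : T.Cell k) :
    T.e b k' hk (T.limIdn h x) = (T.C b).idn (k' := ⟨k'.1, natLe hk⟩) h
      (T.e b k (by omega) x) := by
  rw [← T.e_e k (b := k'.1) (by omega) hk]
  exact (T.t b hk).map_idn (k := ⟨k.1, _⟩) (k' := top k'.1) h _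

theorem e_comp (b : ℕ) {i m k l : Dim ⊤} (u : T.Cell k) (v : T.Cell l)
    (h : T.glob.Composable i m u v) (hm : m.1 ≤ b) :
    T.e b m hm (T.limComp i m u v h) = (T.C b).comp _ _ _ _ (composable h hm) := by
  have hm' := h.hm
  refine ((T.t b hm).map_comp (m := top m.1) _ _ (composable h le_rfl)).trans ?_
  exact GenMap.comp_congr (T.C b) (T.e_e k (by omega) hm u) (T.e_e l (by omega) hm v) _ _

/-- The `ω`-precategory whose `n`-truncations are the `n`-precategories of the tower. -/
noncomputable def lim : Precat.{u} ⊤ where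
  toGlobularSet := T.glob
  idn h x := T.limIdn h x
  comp i m _ _ u v h := T.limComp i m u v h
  bd_idn ε k k' h x := (T.e k'.1 k (by omega)).injective (by
    rw [T.e_bd k'.1 ε (by omega) le_rfl, T.e_idn k'.1 h le_rfl]
    exact (T.C k'.1).bd_idn ε (k := ⟨k.1, _⟩) (k' := ⟨k'.1, _⟩) h _)
  bd_comp_lt ε i j k l hkl hj u v h h' := (T.e l.1 j (by omega)).injective (by
    have := composable h' (b := l.1) (by omega)
    simp only [T.e_bd l.1 ε (show j.1 ≤ l.1 by omega) le_rfl] at this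
    rw [T.e_bd l.1 ε (by omega) le_rfl, T.e_comp l.1 _ _ _ le_rfl,
      T.e_comp l.1 _ _ _ (by omega)]
    refine ((T.C l.1).bd_comp_lt ε (i := ⟨i.1, _⟩) (j := ⟨j.1, _⟩) (k := ⟨k.1, _⟩)
      (l := ⟨l.1, _⟩) hkl hj _ _ _ this).trans ?_
    exact GenMap.comp_congr _ rfl (T.e_bd l.1 ε _ le_rfl v).symm _ _)
  bd_comp_gt ε i j k l hkl hj u v h h' := (T.e k.1 j (by omega)).injective (by
    have := composable h' (b := k.1) (by omega)
    simp only [T.e_bd k.1 ε (show j.1 ≤ k.1 by omega) le_rfl] at this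
    rw [T.e_bd k.1 ε (by omega) le_rfl, T.e_comp k.1 _ _ _ le_rfl,
      T.e_comp k.1 _ _ _ (by omega)]
    refine ((T.C k.1).bd_comp_gt ε (i := ⟨i.1, _⟩) (j := ⟨j.1, _⟩) (k := ⟨k.1, _⟩)
      (l := ⟨l.1, _⟩) hkl hj _ _ _ this).trans ?_
    exact GenMap.comp_congr _ (T.e_bd k.1 ε _ le_rfl u).symm rfl _ _)
  src_comp {i k} hi u v h := (T.e k.1 i (by omega)).injective (by
    rw [T.e_bd k.1 false (by omega) le_rfl, T.e_bd k.1 false (by omega) le_rfl,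
      T.e_comp k.1 _ _ _ le_rfl]
    exact (T.C k.1).src_comp (i := ⟨i.1, _⟩) (k := ⟨k.1, _⟩) hi _ _ _)
  tgt_comp {i k} hi u v h := (T.e k.1 i (by omega)).injective (by
    rw [T.e_bd k.1 true (by omega) le_rfl, T.e_bd k.1 true (by omega) le_rfl,
      T.e_comp k.1 _ _ _ le_rfl]
    exact (T.C k.1).tgt_comp (i := ⟨i.1, _⟩) (k := ⟨k.1, _⟩) hi _ _ _)
  idn_comp {i k k' l} hk hl u v h := (T.e l.1 l le_rfl).injective (by
    have := composable h (b := l.1) le_rfl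
    simp only [T.e_idn l.1 hk hl] at this
    rw [T.e_comp l.1 _ _ _ le_rfl]
    exact (GenMap.comp_congr _ (T.e_idn l.1 hk hl u) rfl _ this).trans
      ((T.C l.1).idn_comp (i := ⟨i.1, _⟩) (k := ⟨k.1, _⟩) (k' := ⟨k'.1, _⟩) (l := ⟨l.1, _⟩)
        hk hl _ _ this))
  idn_comp' {i k k' l} hk hl u v h h' := (T.e k'.1 k' le_rfl).injective (by
    have := composable h (b := k'.1) le_rfl
    simp only [T.e_idn k'.1 hk le_rfl] at this
    rw [T.e_comp k'.1 _ _ h le_rfl, T.e_idn k'.1 hk le_rfl (T.limComp i k u v h'),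
      T.e_comp k'.1 _ _ h' (by omega)]
    exact (GenMap.comp_congr _ (T.e_idn k'.1 hk le_rfl u) rfl _ this).trans
      ((T.C k'.1).idn_comp' (i := ⟨i.1, _⟩) (k := ⟨k.1, _⟩) (k' := ⟨k'.1, _⟩) (l := ⟨l.1, _⟩)
        hk hl _ _ this _))
  comp_idn {i k l l'} hk hl u v h := (T.e k.1 k le_rfl).injective (by
    have := composable h (b := k.1) le_rfl
    simp only [T.e_idn k.1 hk hl] at this
    rw [T.e_comp k.1 _ _ _ le_rfl]
    exact (GenMap.comp_congr _ rfl (T.e_idn k.1 hk hl v) _ this).trans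
      ((T.C k.1).comp_idn (i := ⟨i.1, _⟩) (k := ⟨k.1, _⟩) (l' := ⟨l'.1, _⟩) (l := ⟨l.1, _⟩)
        hk hl _ _ this))
  comp_idn' {i k l l'} hk hl u v h h' := (T.e l'.1 l' le_rfl).injective (by
    have := composable h (b := l'.1) le_rfl
    simp only [T.e_idn l'.1 hk le_rfl] at this
    rw [T.e_comp l'.1 _ _ h le_rfl, T.e_idn l'.1 hk le_rfl (T.limComp i l u v h'),
      T.e_comp l'.1 _ _ h' (by omega)]
    exact (GenMap.comp_congr _ rfl (T.e_idn l'.1 hk le_rfl v) _ this).trans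
      ((T.C l'.1).comp_idn' (i := ⟨i.1, _⟩) (k := ⟨k.1, _⟩) (l' := ⟨l'.1, _⟩) (l := ⟨l.1, _⟩)
        hk hl _ _ this _))
  assoc {i k l m p q r} u v w h₁ h₂ h₃ h₄ := (T.e r.1 r le_rfl).injective (by
    have a₂ := h₂.hm
    have a₄ := h₄.hm
    have c₂ := composable h₂ (b := r.1) le_rfl
    have c₄ := composable h₄ (b := r.1) le_rfl
    simp only [T.e_comp r.1 _ _ h₁ (show p.1 ≤ r.1 by omega)] at c₂
    simp only [T.e_comp r.1 _ _ h₃ (show q.1 ≤ r.1 by omega)] at c₄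
    rw [T.e_comp r.1 _ _ h₂ le_rfl, T.e_comp r.1 _ _ h₄ le_rfl]
    refine (GenMap.comp_congr _ (T.e_comp r.1 _ _ h₁ (by omega)) rfl _ c₂).trans
      (.trans ?_ (GenMap.comp_congr _ rfl (T.e_comp r.1 _ _ h₃ (by omega)).symm c₄ _))
    exact (T.C r.1).assoc (i := ⟨i.1, _⟩) (k := ⟨k.1, _⟩) (l := ⟨l.1, _⟩) (m := ⟨m.1, _⟩)
      (p := ⟨p.1, _⟩) (q := ⟨q.1, _⟩) (r := ⟨r.1, _⟩) _ _ _ _ _ _ _)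
  distrib_left {i j k l l' m} hij u v v' h₁ h₂ h₃ h₄ h₅ := (T.e m.1 m le_rfl).injective (by
    have a₁ := h₁.hm
    have c₂ := composable h₂ (b := m.1) le_rfl
    have c₅ := composable h₅ (b := m.1) le_rfl
    simp only [T.e_comp m.1 _ _ h₁ le_rfl] at c₂
    simp only [T.e_comp m.1 _ _ h₃ (show l.1 ≤ m.1 by omega),
      T.e_comp m.1 _ _ h₄ (show l'.1 ≤ m.1 by omega)] at c₅
    rw [T.e_comp m.1 _ _ h₂ le_rfl, T.e_comp m.1 _ _ h₅ le_rfl]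
    refine (GenMap.comp_congr _ rfl (T.e_comp m.1 _ _ h₁ le_rfl) _ c₂).trans
      (.trans ?_ (GenMap.comp_congr _ (T.e_comp m.1 _ _ h₃ (by omega)).symm
        (T.e_comp m.1 _ _ h₄ (by omega)).symm c₅ _))
    exact (T.C m.1).distrib_left (i := ⟨i.1, _⟩) (j := ⟨j.1, _⟩) (k := ⟨k.1, _⟩) (l := ⟨l.1, _⟩)
      (l' := ⟨l'.1, _⟩) (m := ⟨m.1, _⟩) hij _ _ _ _ _ _ _ _)
  distrib_right {i j k l l' m} hij u u' v h₁ h₂ h₃ h₄ h₅ := (T.e m.1 m le_rfl).injective (by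
    have a₁ := h₁.hm
    have c₂ := composable h₂ (b := m.1) le_rfl
    have c₅ := composable h₅ (b := m.1) le_rfl
    simp only [T.e_comp m.1 _ _ h₁ le_rfl] at c₂
    simp only [T.e_comp m.1 _ _ h₃ (show l.1 ≤ m.1 by omega),
      T.e_comp m.1 _ _ h₄ (show l'.1 ≤ m.1 by omega)] at c₅
    rw [T.e_comp m.1 _ _ h₂ le_rfl, T.e_comp m.1 _ _ h₅ le_rfl]
    refine (GenMap.comp_congr _ (T.e_comp m.1 _ _ h₁ le_rfl) rfl _ c₂).trans
      (.trans ?_ (GenMap.comp_congr _ (T.e_comp m.1 _ _ h₃ (by omega)).symm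
        (T.e_comp m.1 _ _ h₄ (by omega)).symm c₅ _))
    exact (T.C m.1).distrib_right (i := ⟨i.1, _⟩) (j := ⟨j.1, _⟩) (k := ⟨k.1, _⟩) (l := ⟨l.1, _⟩)
      (l' := ⟨l'.1, _⟩) (m := ⟨m.1, _⟩) hij _ _ _ _ _ _ _ _)

/-- Morphisms of towers. -/
structure Hom (T T' : Tower.{u}) where
  app : ∀ n, T.C n ⟶ T'.C n
  comm : ∀ n, T.φ n ≫ (truncSucc n).map (app (n + 1)) = app n ≫ T'.φ n

namespace Hom

variable {T} {T' : Tower.{u}} (F : Hom T T')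

theorem r_map {a b : ℕ} (h : a ≤ b) (k : ℕ) (hk : k ≤ a) (x : (T.C a).cell ⟨k, natLe hk⟩) :
    T'.r h k hk ((F.app a).map ⟨k, natLe hk⟩ x) = (F.app b).map ⟨k, _⟩ (T.r h k hk x) := by
  induction b, h using Nat.le_induction with
  | base => rw [r_self, r_self]
  | succ b hb ih =>
    rw [r_succ _ hb, ih, r_succ _ hb]
    have := congrArg (fun H : T.C b ⟶ (truncSucc b).obj (T'.C (b + 1)) =>
      H.map ⟨k, natLe (hk.trans hb)⟩ (T.r hb k hk x)) (F.comm b)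
    exact this.symm

/-- The action on cells of the induced morphism. -/
def limMap (k : Dim ⊤) (x : T.Cell k) : T'.Cell k := (F.app k.1).map (top k.1) x

theorem e_map (b : ℕ) (k : Dim ⊤) (h : k.1 ≤ b) (x : T.Cell k) :
    T'.e b k h (F.limMap k x) = (F.app b).map ⟨k.1, natLe h⟩ (T.e b k h x) :=
  F.r_map h k.1 le_rfl x

/-- The induced morphism between the limits. -/
noncomputable def limHom : T.lim ⟶ T'.lim where
  map k x := F.limMap k x
  map_bd ε i k h x := (T'.e k.1 i h).injective (by
    refine (F.e_map k.1 i h _).trans (.trans ?_ (T'.e_bd k.1 ε h le_rfl _).symm)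
    refine (congrArg _ (T.e_bd k.1 ε h le_rfl x)).trans ?_
    refine ((F.app k.1).map_bd ε (i := ⟨i.1, natLe h⟩) (k := top k.1) h _).trans ?_
    exact congrArg (fun z => (T'.C k.1).bd ε ⟨i.1, natLe h⟩ z h) (F.e_map k.1 k le_rfl x).symm)
  map_idn {k k'} h x := by
    refine ((F.app k'.1).map_idn (k := ⟨k.1, _⟩) (k' := top k'.1) h _).trans ?_
    exact congrArg _ (F.e_map _ _ _ x).symm
  map_comp {i m k l} u v h := by
    refine ((F.app m.1).map_comp (m := top m.1) _ _ (composable h le_rfl)).trans ?_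
    exact GenMap.comp_congr _ (F.e_map _ _ _ u).symm (F.e_map _ _ _ v).symm _ _

end Hom

end Tower

end Precat

namespace Precat

theorem Gens.incl_bijective {n : ℕ} {C : Precat.{u} n} (X : Gens C) (k : Dim n) :
    Function.Bijective (X.incl.map k) := by
  constructor
  · intro x y h
    exact ExtCell.old.inj h
  · rintro (⟨hk, c⟩ | ⟨hk, c⟩)
    · exact ⟨c, rfl⟩
    · have := Dim.le k
      dsimp only at hk
      omega

theorem bijective_of_isIso {m : ℕ∞} {C D : Precat.{u} m} (F : C ⟶ D) [IsIso F] (k : Dim m) :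
    Function.Bijective (F.map k) := by
  refine Function.bijective_iff_has_inverse.mpr ⟨(inv F).map k, fun x => ?_, fun x => ?_⟩
  · exact congrArg (fun H : C ⟶ C => H.map k x) (IsIso.hom_inv_id F)
  · exact congrArg (fun H : D ⟶ D => H.map k x) (IsIso.inv_hom_id F)

end Precat

namespace OmegaPol

/-- The tower of the free `n`-precategories on the truncations of an `ω`-polygraph. -/
noncomputable def tower (P : OmegaPol.{u}) : Precat.Tower.{u} where
  C n := (Pol.free n).obj (P.obj n)
  φ n := (Pol.free n).map (eqToHom (P.trunc_obj n).symm) ≫ Pol.freeTrunc n (P.obj (n + 1))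
  bij n k := by
    have h₁ := Precat.bijective_of_isIso ((Pol.free n).map (eqToHom (P.trunc_obj n).symm)) k
    have h₂ := Precat.Gens.incl_bijective
      (Precat.CellExt.gens (F := (polData.{u} n).free) (P.obj (n + 1))) k
    exact h₂.comp h₁

theorem _root_.Pol.freeTrunc_naturality (n : ℕ) {P Q : Pol.{u} (n + 1)} (F : P ⟶ Q) :
    Pol.freeTrunc n P ≫ (Precat.truncSucc n).map ((Pol.free (n + 1)).map F)
      = (Pol.free n).map ((Pol.trunc n).map F) ≫ Pol.freeTrunc n Q :=
  (Precat.CellExt.genMap (polData.{u} n).free F).lift_incl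

theorem tower_comm {P Q : OmegaPol.{u}} (F : P ⟶ Q) (n : ℕ) :
    ((Pol.free n).map (eqToHom (P.trunc_obj n).symm) ≫ Pol.freeTrunc n (P.obj (n + 1))) ≫
      (Precat.truncSucc n).map ((Pol.free (n + 1)).map (F.map (n + 1)))
    = (Pol.free n).map (F.map n) ≫
      (Pol.free n).map (eqToHom (Q.trunc_obj n).symm) ≫ Pol.freeTrunc n (Q.obj (n + 1)) := by
  rw [Category.assoc, Pol.freeTrunc_naturality, ← Category.assoc, ← Category.assoc,
    ← Functor.map_comp, ← Functor.map_comp]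
  congr 2
  rw [← cancel_mono (eqToHom (Q.trunc_obj n)), Category.assoc, F.trunc_map]
  simp

/-- The functor `P ↦ P*` from `ω`-polygraphs to `ω`-precategories; the `n`-truncation of `P*` is
the free `n`-precategory on the `n`-truncation of `P`. -/
noncomputable def free : OmegaPol.{u} ⥤ Precat.{u} ⊤ where
  obj P := P.tower.lim
  map {P Q} F := Precat.Tower.Hom.limHom (T := P.tower) (T' := Q.tower)
    { app := fun n => (Pol.free n).map (F.map n), comm := tower_comm F }
  map_id P := by
    ext k x
    exact congrArg (fun H : (Pol.free k.1).obj (P.obj k.1) ⟶ _ => H.map (Precat.top k.1) x)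
      ((Pol.free k.1).map_id (P.obj k.1))
  map_comp {P Q R} F G := by
    ext k x
    exact congrArg (fun H : (Pol.free k.1).obj (P.obj k.1) ⟶ (Pol.free k.1).obj (R.obj k.1) =>
      H.map (Precat.top k.1) x) ((Pol.free k.1).map_comp (F.map k.1) (G.map k.1))

end OmegaPol

/-! The substance is (ii) ⇒ (iii). A map injective on generators has to induce a map injective on
cells, although an equality between images in `Q*` might be witnessed by a chain of axioms passing
through formal cells outside the image of `P*`. The remedy is to prove more by induction on the
dimension: the prefunctor is injective and its image contains the factors of every composite it
contains (`Hom.IsConvex`). Rewriting by the axioms then never leaves the image.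

For the inductive step, take a convex `G : C ⟶ D` and a map `f` from the generators `X` over `C` to
the generators `Y` over `D`, compatible with boundaries. To a formal cell `p` over `Y` is attached,
by recursion on `p`, the set `p.lifts G f` of the free cells over `X` obtained by lifting every
constituent of `p`. Convexity of `G` makes this set invariant under the congruence (`Rel.lifts_eq`).
When `f` is injective, each free cell `t` over `X` is the only lift of some formal cell
(`exists_lifts_eq`). Hence `t` is sent to the class of `p` exactly when `t` is a lift of `p`, and
then it is the only one. This gives injectivity. It gives closure under factors too, since a lift of
a formal composite is by definition a composite of lifts. So `C[X] ⟶ D[Y]` is again convex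
(`isConvex_lift`), and a prefunctor injective on cells is a monomorphism.

For (iii) ⇒ (i), the free functor is faithful, hence reflects monomorphisms. Faithfulness reduces to
the fact that distinct generators give distinct cells, which follows by counting occurrences of a
generator.

For (i) ⇒ (ii), one again goes up the dimensions. Once `F` is injective on generators up to
dimension `n`, convexity makes `F*` injective on `n`-cells. Two `(n+1)`-generators with the same
image are then parallel, and a polygraph with a generator of that boundary has two morphisms to `P`
that `F` identifies. For finite `n` a single extra generator suffices, since truncation preserves
monomorphisms. For `ω` one test object serves all dimensions: the double of `P`, whose generators
are the pairs of parallel generators identified by `F`. -/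

namespace Precat

/-! ### Convex prefunctors -/

/-- A prefunctor which is injective on cells and whose image contains the factors of each composite
that it contains. -/
structure Hom.IsConvex {n : ℕ∞} {C D : Precat.{u} n} (G : C ⟶ D) : Prop where
  inj : ∀ k, Function.Injective (G.map k)
  left : ∀ {i m k l : Dim n} (u : D.cell k) (v : D.cell l) (h) (w : C.cell m),
    G.map m w = D.comp i m u v h → ∃ u', G.map k u' = u
  right : ∀ {i m k l : Dim n} (u : D.cell k) (v : D.cell l) (h) (w : C.cell m),
    G.map m w = D.comp i m u v h → ∃ v', G.map l v' = v

theorem Hom.IsConvex.composable {n : ℕ∞} {C D : Precat.{u} n} {G : C ⟶ D} (hG : Hom.IsConvex G)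
    {i m k l : Dim n} {u : C.cell k} {v : C.cell l}
    (h : D.Composable i m (G.map k u) (G.map l v)) : C.Composable i m u v :=
  ⟨h.hi, h.hm, hG.inj _ (by rw [G.map_bd, G.map_bd, h.eq])⟩

/-- Convexity lifts the two factors, and injectivity then makes the lifts composable with composite
`w`. This is how a decomposition in `D` is carried back to `C`. -/
theorem Hom.IsConvex.exists_comp {n : ℕ∞} {C D : Precat.{u} n} {G : C ⟶ D} (hG : Hom.IsConvex G)
    {i m k l : Dim n} {u : D.cell k} {v : D.cell l} {h} {w : C.cell m}
    (e : G.map m w = D.comp i m u v h) :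
    ∃ u' v' h', G.map k u' = u ∧ G.map l v' = v ∧ w = C.comp i m u' v' h' := by
  obtain ⟨u', rfl⟩ := hG.left u v h w e
  obtain ⟨v', rfl⟩ := hG.right _ v h w e
  refine ⟨u', v', hG.composable h, rfl, rfl, hG.inj _ ?_⟩
  rw [e, G.map_comp]

/-- An identity is determined by its own target, which lies in the image along with it. This is why
convexity needs no separate clause for identities. -/
theorem Hom.IsConvex.exists_idn {n : ℕ∞} {C D : Precat.{u} n} {G : C ⟶ D} (hG : Hom.IsConvex G)
    {k k' : Dim n} {hk : k.1 + 1 = k'.1} {x : D.cell k} {w : C.cell k'}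
    (e : G.map k' w = D.idn hk x) : ∃ x', G.map k x' = x ∧ w = C.idn hk x' := by
  have hx : G.map k (C.bd true k w (by omega)) = x := by rw [G.map_bd, e, D.bd_idn]
  refine ⟨_, hx, hG.inj _ ?_⟩
  rw [e, G.map_idn, hx]

/-! ### Lifts of formal cells and their invariance under the axioms -/

namespace Gens

variable {n : ℕ} {C D : Precat.{u} n} (G : C ⟶ D) {X : Gens C} {Y : Gens D} (f : X.gen → Y.gen)

/-- The free cells over `X` that lie above a formal cell over `Y`. -/
def Term.lifts : ∀ {a b : D.cell (top n)}, Y.Term a b → Set (Free X)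
  | _, _, .gen y => {s | ∃ x, f x = y ∧ s = .mk (.gen x)}
  | _, _, .idn c => {s | ∃ c', G.map _ c' = c ∧ s = .mk (.idn c')}
  -- The matching of boundaries in `C` is part of the data here. When `G` is convex it is automatic,
  -- by `bd_eq_of_mem_lifts`; the same holds for the two whiskerings, by `composable_left` and
  -- `composable_right`.
  | _, _, .comp _ p q => {s | ∃ t r h, t ∈ p.lifts ∧ r ∈ q.lifts ∧ s = Free.comp t r h}
  | _, _, .lw (i := i) u _ _ p =>
    {s | ∃ u' t h, G.map _ u' = u ∧ t ∈ p.lifts ∧ s = Free.lw (i := i) u' t h}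
  | _, _, .rw (i := i) u _ _ p =>
    {s | ∃ u' t h, G.map _ u' = u ∧ t ∈ p.lifts ∧ s = Free.rw (i := i) t u' h}

variable {G f}

/-- The boundary of a lift is prescribed by `p` up to `G`. With `G` injective, every composability
condition on lifts can therefore be checked in `D`, where the formal cell already provides it. -/
theorem Term.bd_of_mem_lifts (hf : ∀ ε x, Y.bd ε (f x) = G.map (top n) (X.bd ε x))
    {a b : D.cell (top n)} (p : Y.Term a b) : ∀ {t : Free X}, t ∈ p.lifts G f →
      ∀ ε, G.map (top n) (t.bd ε) = bif ε then b else a := by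
  induction p with
  | gen y =>
    rintro _ ⟨x, rfl, rfl⟩ ε
    cases ε <;> exact (hf _ x).symm
  | idn c =>
    rintro _ ⟨c, rfl, rfl⟩ ε
    cases ε <;> rfl
  | comp h p q hp hq =>
    rintro _ ⟨t, r, e, ht, hr, rfl⟩ ε
    refine (congrArg _ (X.freeLayer.bd_comp ε t r e)).trans ?_
    cases ε
    exacts [hp ht false, hq hr true]
  | lw u ha hb p hp =>
    rintro _ ⟨u, t, h, rfl, ht, rfl⟩ ε
    refine (congrArg _ (X.freeLayer.bd_lw ε u t h)).trans ((G.map_comp _ _ (h ε)).trans ?_)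
    cases ε
    exacts [GenMap.comp_congr D rfl (hp ht false) _ _, GenMap.comp_congr D rfl (hp ht true) _ _]
  | rw u ha hb p hp =>
    rintro _ ⟨u, t, h, rfl, ht, rfl⟩ ε
    refine (congrArg _ (X.freeLayer.bd_rw ε u t h)).trans ((G.map_comp _ _ (h ε)).trans ?_)
    cases ε
    exacts [GenMap.comp_congr D (hp ht false) rfl _ _, GenMap.comp_congr D (hp ht true) rfl _ _]

theorem Term.bd_eq_of_mem_lifts (hG : Hom.IsConvex G)
    (hf : ∀ ε x, Y.bd ε (f x) = G.map (top n) (X.bd ε x))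
    {a b b' c : D.cell (top n)} {p : Y.Term a b} {q : Y.Term b' c}
    {t r : Free X} (h : b = b') (ht : t ∈ p.lifts G f) (hr : r ∈ q.lifts G f) :
    t.bd true = r.bd false :=
  hG.inj _ (((p.bd_of_mem_lifts hf ht true).trans h).trans (q.bd_of_mem_lifts hf hr false).symm)

theorem Term.composable_left (hG : Hom.IsConvex G)
    (hf : ∀ ε x, Y.bd ε (f x) = G.map (top n) (X.bd ε x))
    {i k : Dim n} {u : C.cell k} {a b : D.cell (top n)} {p : Y.Term a b}
    {t : Free X} (ht : t ∈ p.lifts G f) (ha : D.Composable i (top n) (G.map k u) a)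
    (hb : D.Composable i (top n) (G.map k u) b) (ε : Bool) :
    C.Composable i (top n) u (t.bd ε) := by
  refine hG.composable ?_
  rw [p.bd_of_mem_lifts hf ht]
  cases ε
  exacts [ha, hb]

theorem Term.composable_right (hG : Hom.IsConvex G)
    (hf : ∀ ε x, Y.bd ε (f x) = G.map (top n) (X.bd ε x))
    {i k : Dim n} {u : C.cell k} {a b : D.cell (top n)} {p : Y.Term a b}
    {t : Free X} (ht : t ∈ p.lifts G f) (ha : D.Composable i (top n) a (G.map k u))
    (hb : D.Composable i (top n) b (G.map k u)) (ε : Bool) :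
    C.Composable i (top n) (t.bd ε) u := by
  refine hG.composable ?_
  rw [p.bd_of_mem_lifts hf ht]
  cases ε
  exacts [ha, hb]

/-- Each axiom is compared with the same axiom in the free layer over `X`. A lift of one side
supplies lifts of the constituents, which reassemble into a lift of the other side with the same
value. Convexity enters when a composite of cells of `D` has a lift and its factors must be lifted
separately; injectivity enters when a cell of `D` occurs twice and has been lifted twice. -/
theorem Rel.lifts_eq (hG : Hom.IsConvex G)
    (hf : ∀ ε x, Y.bd ε (f x) = G.map (top n) (X.bd ε x))
    {a b a' b' : D.cell (top n)} {p : Y.Term a b} {q : Y.Term a' b'}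
    (h : Rel p q) : p.lifts G f = q.lifts G f := by
  induction h with
  | refl p => rfl
  | symm _ h => exact h.symm
  | trans _ _ h h' => exact h.trans h'
  | comp_congr _ _ h h' => simp only [Term.lifts, h, h']
  | lw_congr _ h => simp only [Term.lifts, h]
  | rw_congr _ h => simp only [Term.lifts, h]
  | idn_comp h p =>
    subst h
    ext s
    constructor
    · rintro ⟨_, r, h, ⟨c, rfl, rfl⟩, hr, rfl⟩
      exact (congrArg (· ∈ p.lifts G f) (X.freeLayer.idn_comp c r h)).mpr hr
    · intro hs
      -- The missing unit is forced: it is the identity on the source of `s`, which lies above the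
      -- source of `p`.
      exact ⟨_, s, rfl, ⟨s.bd false, p.bd_of_mem_lifts hf hs false, rfl⟩, hs,
        (X.freeLayer.idn_comp _ s rfl).symm⟩
  | comp_idn h p =>
    subst h
    ext s
    constructor
    · rintro ⟨r, _, h, hr, ⟨c, rfl, rfl⟩, rfl⟩
      exact (congrArg (· ∈ p.lifts G f) (X.freeLayer.comp_idn c r h)).mpr hr
    · intro hs
      exact ⟨s, _, rfl, hs, ⟨s.bd true, p.bd_of_mem_lifts hf hs true, rfl⟩,
        (X.freeLayer.comp_idn _ s rfl).symm⟩
  | @assoc _ _ _ _ _ _ h h' p q r =>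
    ext s
    constructor
    · rintro ⟨_, z, e, ⟨x, y, e', hx, hy, rfl⟩, hz, rfl⟩
      have hyz := Term.bd_eq_of_mem_lifts hG hf h' hy hz
      exact ⟨x, Free.comp y z hyz, e'.trans (X.freeLayer.bd_comp false y z hyz).symm, hx, ⟨y, z, hyz, hy, hz, rfl⟩,
        X.freeLayer.assoc x y z e' e hyz (e'.trans (X.freeLayer.bd_comp false y z hyz).symm)⟩
    · rintro ⟨x, _, e, hx, ⟨y, z, e', hy, hz, rfl⟩, rfl⟩
      have hxy := Term.bd_eq_of_mem_lifts hG hf h hx hy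
      exact ⟨Free.comp x y hxy, z, (X.freeLayer.bd_comp true x y hxy).trans e', ⟨x, y, hxy, hx, hy, rfl⟩, hz,
        (X.freeLayer.assoc x y z hxy ((X.freeLayer.bd_comp true x y hxy).trans e') e' e).symm⟩
  | lw_idn u c h =>
    ext s
    constructor
    · rintro ⟨u, _, e, rfl, ⟨c, rfl, rfl⟩, rfl⟩
      exact ⟨C.comp _ _ u c (e true), G.map_comp _ _ _, X.freeLayer.lw_idn u c e _⟩
    · rintro ⟨d, e, rfl⟩
      -- Only the lift `d` of the whole composite is known; closure under factors splits it.
      obtain ⟨u, c, h', rfl, rfl, rfl⟩ := hG.exists_comp e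
      have e : ∀ ε, C.Composable _ (top n) u (Free.bd (X := X) ε (.mk (.idn c))) := fun ε => by
        cases ε <;> exact h'
      exact ⟨u, _, e, rfl, ⟨c, rfl, rfl⟩, (X.freeLayer.lw_idn u c e h').symm⟩
  | rw_idn u c h =>
    ext s
    constructor
    · rintro ⟨u, _, e, rfl, ⟨c, rfl, rfl⟩, rfl⟩
      exact ⟨C.comp _ _ c u (e true), G.map_comp _ _ _, X.freeLayer.rw_idn u c e _⟩
    · rintro ⟨d, e, rfl⟩
      obtain ⟨c, u, h', rfl, rfl, rfl⟩ := hG.exists_comp e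
      have e : ∀ ε, C.Composable _ (top n) (Free.bd (X := X) ε (.mk (.idn c))) u := fun ε => by
        cases ε <;> exact h'
      exact ⟨u, _, e, rfl, ⟨c, rfl, rfl⟩, (X.freeLayer.rw_idn u c e h').symm⟩
  | @idn_lw i k hi x a b p ha hb =>
    ext s
    constructor
    · rintro ⟨u, t, h, e, ht, rfl⟩
      obtain ⟨x, rfl, rfl⟩ := hG.exists_idn e
      exact (congrArg (· ∈ p.lifts G f) (X.freeLayer.idn_lw hi x t h)).mpr ht
    · intro hs
      have hi' : i.1 ≤ n := Dim.le i
      -- The formal cell `p` does not contain `x`, so its lift has to be found elsewhere: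
      -- composability makes `x` the `i`-source of `a`, hence the image of the `i`-source of `s`.
      have hx : G.map i (C.bd false i (s.bd false) hi') = x := by
        rw [G.map_bd, p.bd_of_mem_lifts hf hs]
        exact ha.eq.symm.trans (D.bd_idn true hi x)
      rw [← hx, ← G.map_idn] at ha hb
      have h := Term.composable_left hG hf hs ha hb
      exact ⟨_, s, h, (G.map_idn hi _).trans (by rw [hx]), hs, (X.freeLayer.idn_lw hi _ s h).symm⟩
  | @rw_of_idn i k hi x a b p ha hb =>
    ext s
    constructor
    · rintro ⟨u, t, h, e, ht, rfl⟩
      obtain ⟨x, rfl, rfl⟩ := hG.exists_idn e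
      exact (congrArg (· ∈ p.lifts G f) (X.freeLayer.rw_of_idn hi x t h)).mpr ht
    · intro hs
      have hi' : i.1 ≤ n := Dim.le i
      -- On the right, `x` is the `i`-target of `a`, hence the image of the `i`-target of the source
      -- of `s`.
      have hx : G.map i (C.bd true i (s.bd false) hi') = x := by
        rw [G.map_bd, p.bd_of_mem_lifts hf hs]
        exact ha.eq.trans (D.bd_idn false hi x)
      rw [← hx, ← G.map_idn] at ha hb
      have h := Term.composable_right hG hf hs ha hb
      exact ⟨_, s, h, (G.map_idn hi _).trans (by rw [hx]), hs, (X.freeLayer.rw_of_idn hi _ s h).symm⟩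
  | lw_lw u v p h₁ h₂ h₂' h₃ h₃' h₄ h₄' =>
    ext s
    constructor
    · rintro ⟨w, t, h, e, ht, rfl⟩
      -- The lift `w` of the composite whisker has to be split into two successive whiskers, which
      -- needs closure under factors.
      obtain ⟨u, v, h', rfl, rfl, rfl⟩ := hG.exists_comp e
      have hv := Term.composable_left hG hf ht h₃ h₃'
      have hm : Free.lw v t hv ∈ Term.lifts G f (.lw _ h₃ h₃' p) := ⟨v, t, hv, rfl, ht, rfl⟩
      have hu := Term.composable_left hG hf hm h₄ h₄'
      exact ⟨u, _, hu, rfl, hm, X.freeLayer.lw_lw u v t h' h hv hu⟩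
    · rintro ⟨u, _, h, rfl, ⟨v, t, h', rfl, ht, rfl⟩, rfl⟩
      have e := G.map_comp _ _ (hG.composable h₁)
      rw [← e] at h₂ h₂'
      have hw := Term.composable_left hG hf ht h₂ h₂'
      exact ⟨_, t, hw, e, ht, (X.freeLayer.lw_lw u v t (hG.composable h₁) hw h' h).symm⟩
  | lw_rw u v p h₁ h₁' h₂ h₂' h₃ h₃' h₄ h₄' =>
    ext s
    constructor
    · rintro ⟨v, _, h, rfl, ⟨u, t, h', rfl, ht, rfl⟩, rfl⟩
      have hv := Term.composable_right hG hf ht h₃ h₃'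
      have hm : Free.rw t v hv ∈ Term.lifts G f (.rw _ h₃ h₃' p) := ⟨v, t, hv, rfl, ht, rfl⟩
      have hu := Term.composable_left hG hf hm h₄ h₄'
      exact ⟨u, _, hu, rfl, hm, X.freeLayer.lw_rw u v t h' h hv hu⟩
    · rintro ⟨u, _, h, rfl, ⟨v, t, h', rfl, ht, rfl⟩, rfl⟩
      have hu := Term.composable_left hG hf ht h₁ h₁'
      have hm : Free.lw u t hu ∈ Term.lifts G f (.lw _ h₁ h₁' p) := ⟨u, t, hu, rfl, ht, rfl⟩
      have hv := Term.composable_right hG hf hm h₂ h₂'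
      exact ⟨v, _, hv, rfl, hm, (X.freeLayer.lw_rw u v t hu hv h' h).symm⟩
  | rw_rw u v p h₁ h₁' h₂ h₂' h₃ h₄ h₄' =>
    ext s
    constructor
    · rintro ⟨v, _, h, rfl, ⟨u, t, h', rfl, ht, rfl⟩, rfl⟩
      have e := G.map_comp _ _ (hG.composable h₃)
      rw [← e] at h₄ h₄'
      have hw := Term.composable_right hG hf ht h₄ h₄'
      exact ⟨_, t, hw, e, ht, X.freeLayer.rw_rw u v t h' h (hG.composable h₃) hw⟩
    · rintro ⟨w, t, h, e, ht, rfl⟩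
      obtain ⟨u, v, h', rfl, rfl, rfl⟩ := hG.exists_comp e
      have hu := Term.composable_right hG hf ht h₁ h₁'
      have hm : Free.rw t u hu ∈ Term.lifts G f (.rw _ h₁ h₁' p) := ⟨u, t, hu, rfl, ht, rfl⟩
      have hv := Term.composable_right hG hf hm h₂ h₂'
      exact ⟨v, _, hv, rfl, hm, (X.freeLayer.rw_rw u v t hu hv h' h).symm⟩
  | lw_comp u p q h₂ h₂' h₃ h₃' h₄ h₄' h₅ =>
    rename_i h
    ext s
    constructor
    · rintro ⟨u, _, e', rfl, ⟨t, r, e, ht, hr, rfl⟩, rfl⟩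
      have et := Term.composable_left hG hf ht h₃ h₃'
      have er := Term.composable_left hG hf hr h₄ h₄'
      have hmt : Free.lw u t et ∈ Term.lifts G f (.lw _ h₃ h₃' p) := ⟨u, t, et, rfl, ht, rfl⟩
      have hmr : Free.lw u r er ∈ Term.lifts G f (.lw _ h₄ h₄' q) := ⟨u, r, er, rfl, hr, rfl⟩
      have h := Term.bd_eq_of_mem_lifts hG hf h₅ hmt hmr
      exact ⟨_, _, h, hmt, hmr, X.freeLayer.lw_comp u t r e e' et er h⟩
    · rintro ⟨_, _, e', ⟨u, t, et, rfl, ht, rfl⟩, ⟨u', r, er, hu, hr, rfl⟩, rfl⟩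
      -- The two halves were lifted independently, with possibly different lifts of the whiskering
      -- cell; injectivity identifies them, so that it can be factored out.
      obtain rfl := hG.inj _ hu
      have e := Term.bd_eq_of_mem_lifts hG hf h ht hr
      have hm : Free.comp t r e ∈ Term.lifts G f (.comp h p q) := ⟨t, r, e, ht, hr, rfl⟩
      have hu := Term.composable_left hG hf hm h₂ h₂'
      exact ⟨_, _, hu, rfl, hm, (X.freeLayer.lw_comp _ t r e hu et er e').symm⟩
  | rw_comp u p q h₂ h₂' h₃ h₃' h₄ h₄' h₅ =>
    rename_i h
    ext s
    constructor
    · rintro ⟨u, _, e', rfl, ⟨t, r, e, ht, hr, rfl⟩, rfl⟩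
      have et := Term.composable_right hG hf ht h₃ h₃'
      have er := Term.composable_right hG hf hr h₄ h₄'
      have hmt : Free.rw t u et ∈ Term.lifts G f (.rw _ h₃ h₃' p) := ⟨u, t, et, rfl, ht, rfl⟩
      have hmr : Free.rw r u er ∈ Term.lifts G f (.rw _ h₄ h₄' q) := ⟨u, r, er, rfl, hr, rfl⟩
      have h := Term.bd_eq_of_mem_lifts hG hf h₅ hmt hmr
      exact ⟨_, _, h, hmt, hmr, X.freeLayer.rw_comp u t r e e' et er h⟩
    · rintro ⟨_, _, e', ⟨u, t, et, rfl, ht, rfl⟩, ⟨u', r, er, hu, hr, rfl⟩, rfl⟩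
      obtain rfl := hG.inj _ hu
      have e := Term.bd_eq_of_mem_lifts hG hf h ht hr
      have hm : Free.comp t r e ∈ Term.lifts G f (.comp h p q) := ⟨t, r, e, ht, hr, rfl⟩
      have hu := Term.composable_right hG hf hm h₂ h₂'
      exact ⟨_, _, hu, rfl, hm, (X.freeLayer.rw_comp _ t r e hu et er e').symm⟩
  | lw_distrib_lw hij u v p h₁ h₁' h₂ h₂' h₃ h₄ h₄' h₅ h₅' =>
    ext s
    constructor
    · rintro ⟨u, _, hu, rfl, ⟨v, t, hv, rfl, ht, rfl⟩, rfl⟩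
      have e := G.map_comp _ _ (hG.composable h₃)
      have h := Term.composable_left hG hf ht h₄ h₄'
      have hm : Free.lw u t h ∈ Term.lifts G f (.lw _ h₄ h₄' p) := ⟨u, t, h, rfl, ht, rfl⟩
      rw [← e] at h₅ h₅'
      have hw := Term.composable_left hG hf hm h₅ h₅'
      exact ⟨_, _, hw, e, hm,
        X.freeLayer.lw_distrib_lw hij u v t hv hu (hG.composable h₃) h hw⟩
    · rintro ⟨w, _, hw, e, ⟨u, t, h, rfl, ht, rfl⟩, rfl⟩
      -- Both properties of `G` are used: the outer whisker `w` splits into lifts of its two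
      -- factors, and the first of these must agree with the lift `u` found in the inner whisker.
      obtain ⟨u', v, h', hu, rfl, rfl⟩ := hG.exists_comp e
      obtain rfl := hG.inj _ hu
      have hv := Term.composable_left hG hf ht h₁ h₁'
      have hm : Free.lw v t hv ∈ Term.lifts G f (.lw _ h₁ h₁' p) := ⟨v, t, hv, rfl, ht, rfl⟩
      have hu := Term.composable_left hG hf hm h₂ h₂'
      exact ⟨_, _, hu, rfl, hm, (X.freeLayer.lw_distrib_lw hij _ v t hv hu h' h hw).symm⟩
  | lw_distrib_rw hij u v p h₁ h₁' h₂ h₂' h₃ h₄ h₄' h₅ h₅' =>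
    ext s
    constructor
    · rintro ⟨u, _, hu, rfl, ⟨v, t, hv, rfl, ht, rfl⟩, rfl⟩
      have e := G.map_comp _ _ (hG.composable h₃)
      have h := Term.composable_left hG hf ht h₄ h₄'
      have hm : Free.lw u t h ∈ Term.lifts G f (.lw _ h₄ h₄' p) := ⟨u, t, h, rfl, ht, rfl⟩
      rw [← e] at h₅ h₅'
      have hw := Term.composable_right hG hf hm h₅ h₅'
      exact ⟨_, _, hw, e, hm,
        X.freeLayer.lw_distrib_rw hij u v t hv hu (hG.composable h₃) h hw⟩
    · rintro ⟨w, _, hw, e, ⟨u, t, h, rfl, ht, rfl⟩, rfl⟩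
      obtain ⟨u', v, h', hu, rfl, rfl⟩ := hG.exists_comp e
      obtain rfl := hG.inj _ hu
      have hv := Term.composable_right hG hf ht h₁ h₁'
      have hm : Free.rw t v hv ∈ Term.lifts G f (.rw _ h₁ h₁' p) := ⟨v, t, hv, rfl, ht, rfl⟩
      have hu := Term.composable_left hG hf hm h₂ h₂'
      exact ⟨_, _, hu, rfl, hm, (X.freeLayer.lw_distrib_rw hij _ v t hv hu h' h hw).symm⟩
  | rw_distrib_lw hij u v p h₁ h₁' h₂ h₂' h₃ h₄ h₄' h₅ h₅' =>
    ext s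
    constructor
    · rintro ⟨u, _, hu, rfl, ⟨v, t, hv, rfl, ht, rfl⟩, rfl⟩
      have e := G.map_comp _ _ (hG.composable h₃)
      have h := Term.composable_right hG hf ht h₄ h₄'
      have hm : Free.rw t u h ∈ Term.lifts G f (.rw _ h₄ h₄' p) := ⟨u, t, h, rfl, ht, rfl⟩
      rw [← e] at h₅ h₅'
      have hw := Term.composable_left hG hf hm h₅ h₅'
      exact ⟨_, _, hw, e, hm,
        X.freeLayer.rw_distrib_lw hij u v t hv hu (hG.composable h₃) h hw⟩
    · rintro ⟨w, _, hw, e, ⟨u, t, h, rfl, ht, rfl⟩, rfl⟩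
      obtain ⟨v, u', h', rfl, hu, rfl⟩ := hG.exists_comp e
      obtain rfl := hG.inj _ hu
      have hv := Term.composable_left hG hf ht h₁ h₁'
      have hm : Free.lw v t hv ∈ Term.lifts G f (.lw _ h₁ h₁' p) := ⟨v, t, hv, rfl, ht, rfl⟩
      have hu := Term.composable_right hG hf hm h₂ h₂'
      exact ⟨_, _, hu, rfl, hm, (X.freeLayer.rw_distrib_lw hij _ v t hv hu h' h hw).symm⟩
  | rw_distrib_rw hij u v p h₁ h₁' h₂ h₂' h₃ h₄ h₄' h₅ h₅' =>
    ext s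
    constructor
    · rintro ⟨u, _, hu, rfl, ⟨v, t, hv, rfl, ht, rfl⟩, rfl⟩
      have e := G.map_comp _ _ (hG.composable h₃)
      have h := Term.composable_right hG hf ht h₄ h₄'
      have hm : Free.rw t u h ∈ Term.lifts G f (.rw _ h₄ h₄' p) := ⟨u, t, h, rfl, ht, rfl⟩
      rw [← e] at h₅ h₅'
      have hw := Term.composable_right hG hf hm h₅ h₅'
      exact ⟨_, _, hw, e, hm,
        X.freeLayer.rw_distrib_rw hij u v t hv hu (hG.composable h₃) h hw⟩
    · rintro ⟨w, _, hw, e, ⟨u, t, h, rfl, ht, rfl⟩, rfl⟩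
      obtain ⟨v, u', h', rfl, hu, rfl⟩ := hG.exists_comp e
      obtain rfl := hG.inj _ hu
      have hv := Term.composable_right hG hf ht h₁ h₁'
      have hm : Free.rw t v hv ∈ Term.lifts G f (.rw _ h₁ h₁' p) := ⟨v, t, hv, rfl, ht, rfl⟩
      have hu := Term.composable_right hG hf hm h₂ h₂'
      exact ⟨_, _, hu, rfl, hm, (X.freeLayer.rw_distrib_rw hij _ v t hv hu h' h hw).symm⟩

end Gens

end Precat

/-! ### Convexity passes to free extensions -/

namespace Precat

namespace Gens

variable {n : ℕ} {C D : Precat.{u} n} {G : C ⟶ D} {X : Gens C} {Y : Gens D} {f : X.gen → Y.gen}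

/-- The data defining the prefunctor `C[X] ⟶ D[Y]` induced by `G : C ⟶ D` and `f : X ⟶ Y`. -/
noncomputable def genMap (hf : ∀ ε x, Y.bd ε (f x) = G.map (top n) (X.bd ε x)) :
    GenMap X Y.freeExt where
  base := G ≫ Y.incl
  gen x := Y.genCell (f x)
  bd_gen ε x := ((univ Y).bd_gen ε (f x)).trans (congrArg (rmap Y.incl (top n)) (hf ε x))

theorem cellOf_eq_iff {a b a' b' : C.cell (top n)} {p : X.Term a b} {q : X.Term a' b'} :
    X.cellOf p = X.cellOf q ↔ Rel p q :=
  ⟨fun h => Free.exact (ExtCell.top.inj h), fun h => congrArg (ExtCell.top rfl) (Free.sound h)⟩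

variable (hf : ∀ ε x, Y.bd ε (f x) = G.map (top n) (X.bd ε x))

/-- The induced map preserves each operation, so lifts of `p` are sent to the class of `p`. This
half uses neither convexity of `G` nor injectivity of `f`. -/
theorem evalFree_of_mem_lifts {a b : D.cell (top n)} (p : Y.Term a b) :
    ∀ {t : Free X}, t ∈ p.lifts G f → (genMap hf).evalFree t = Y.cellOf p := by
  induction p with
  | gen y =>
    rintro _ ⟨x, rfl, rfl⟩
    rfl
  | idn c =>
    rintro _ ⟨c, rfl, rfl⟩
    exact (cellOf_idn (X := Y) (G.map (top n) c)).symm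
  | comp h p q hp hq =>
    rintro _ ⟨t, r, e, ht, hr, rfl⟩
    obtain ⟨h', e'⟩ := cellOf_comp h p q
    simp only [e', ← hp ht, ← hq hr]
    exact (genMap hf).evalFree_comp t r e _
  | lw u ha hb p hp =>
    rintro _ ⟨u, t, h, rfl, ht, rfl⟩
    obtain ⟨h', e'⟩ := cellOf_lw _ ha hb p
    simp only [e', ← hp ht]
    exact (genMap hf).evalFree_lw u t h _
  | rw u ha hb p hp =>
    rintro _ ⟨u, t, h, rfl, ht, rfl⟩
    obtain ⟨h', e'⟩ := cellOf_rw _ ha hb p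
    simp only [e', ← hp ht]
    exact (genMap hf).evalFree_rw u t h _

/-- The formal cell is obtained from a representative of `t` by applying `f` to its generators and
`G` to its other constituents. Uniqueness of the lift goes up by induction, from injectivity of `f`
at generators and of `G` at identities and whiskering cells. -/
theorem exists_lifts_eq (hf : ∀ ε x, Y.bd ε (f x) = G.map (top n) (X.bd ε x)) (hG : Hom.IsConvex G) (hinj : Function.Injective f)
    (t : Free X) : ∃ (a b : D.cell (top n)) (p : Y.Term a b), p.lifts G f = {t} := by
  induction t using Free.ind with | @h a b p => ?_
  -- The boundary of the formal cell is added to the induction claim, since otherwise the images of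
  -- two composable formal cells could not be composed.
  suffices ∃ (a' b' : D.cell (top n)) (q : Y.Term a' b'), a' = G.map _ a ∧ b' = G.map _ b ∧
      q.lifts G f = {Free.mk p} by
    obtain ⟨a', b', q, -, -, h⟩ := this
    exact ⟨a', b', q, h⟩
  induction p with
  | gen x =>
    refine ⟨_, _, .gen (f x), hf _ x, hf _ x, ?_⟩
    ext s
    constructor
    · rintro ⟨x', h, rfl⟩
      rw [hinj h]; rfl
    · rintro rfl
      exact ⟨x, rfl, rfl⟩
  | idn c =>
    refine ⟨_, _, .idn (G.map _ c), rfl, rfl, ?_⟩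
    ext s
    constructor
    · rintro ⟨c', h, rfl⟩
      rw [hG.inj _ h]; rfl
    · rintro rfl
      exact ⟨c, rfl, rfl⟩
  | comp h p q hp hq =>
    subst h
    obtain ⟨_, _, p', rfl, rfl, hp⟩ := hp
    obtain ⟨_, _, q', rfl, rfl, hq⟩ := hq
    refine ⟨_, _, .comp rfl p' q', rfl, rfl, ?_⟩
    ext s
    simp only [Term.lifts, hp, hq]
    constructor
    · rintro ⟨_, _, h, rfl, rfl, rfl⟩
      exact Free.comp_mk p q h
    · rintro rfl
      exact ⟨_, _, rfl, rfl, rfl, (Free.comp_mk p q rfl).symm⟩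
  | @lw i k u a b ha hb p hp =>
    obtain ⟨_, _, p', rfl, rfl, hp⟩ := hp
    refine ⟨_, _, .lw (G.map k u) (G.composable ha) (G.composable hb) p', (G.map_comp _ _ ha).symm,
      (G.map_comp _ _ hb).symm, ?_⟩
    ext s
    simp only [Term.lifts, hp]
    constructor
    · rintro ⟨u', _, h, hu, rfl, rfl⟩
      obtain rfl := hG.inj _ hu
      exact Free.lw_mk _ p h
    · rintro rfl
      have h : ∀ ε, C.Composable i (top n) u ((Free.mk p).bd ε) := fun ε => by
        cases ε
        exacts [ha, hb]
      exact ⟨_, _, h, rfl, rfl, (Free.lw_mk _ p h).symm⟩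
  | @rw i k u a b ha hb p hp =>
    obtain ⟨_, _, p', rfl, rfl, hp⟩ := hp
    refine ⟨_, _, .rw (G.map k u) (G.composable ha) (G.composable hb) p', (G.map_comp _ _ ha).symm,
      (G.map_comp _ _ hb).symm, ?_⟩
    ext s
    simp only [Term.lifts, hp]
    constructor
    · rintro ⟨u', _, h, hu, rfl, rfl⟩
      obtain rfl := hG.inj _ hu
      exact Free.rw_mk _ p h
    · rintro rfl
      have h : ∀ ε, C.Composable i (top n) ((Free.mk p).bd ε) u := fun ε => by
        cases ε
        exacts [ha, hb]
      exact ⟨_, _, h, rfl, rfl, (Free.rw_mk _ p h).symm⟩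

/-- Let `q` be a formal cell whose only lift is `t`. Then `p` and `q` both denote the image of `t`,
so they are congruent and have the same lifts. -/
theorem lifts_eq_singleton (hG : Hom.IsConvex G) (hinj : Function.Injective f)
    {a b : D.cell (top n)} {p : Y.Term a b} {t : Free X}
    (h : (genMap hf).evalFree t = Y.cellOf p) : p.lifts G f = {t} := by
  obtain ⟨a', b', q, hq⟩ := exists_lifts_eq hf hG hinj t
  have e := evalFree_of_mem_lifts hf q (t := t) (hq ▸ rfl)
  rw [← hq]
  exact Rel.lifts_eq hG hf (cellOf_eq_iff.mp (h.symm.trans e))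

theorem evalFree_eq_cellOf_iff (hG : Hom.IsConvex G) (hinj : Function.Injective f)
    {a b : D.cell (top n)} {p : Y.Term a b} {t : Free X} :
    (genMap hf).evalFree t = Y.cellOf p ↔ t ∈ p.lifts G f :=
  ⟨fun h => lifts_eq_singleton hf hG hinj h ▸ rfl, evalFree_of_mem_lifts hf p⟩

/-- If `s` and `t` have the same image, then `s` is also a lift of the formal cell whose only lift
is `t`. -/
theorem evalFree_injective (hG : Hom.IsConvex G) (hinj : Function.Injective f) :
    Function.Injective (genMap hf).evalFree := by
  intro s t h
  obtain ⟨a, b, p, hp⟩ := exists_lifts_eq hf hG hinj t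
  have ht := evalFree_of_mem_lifts hf p (t := t) (hp ▸ rfl)
  have hs := (evalFree_eq_cellOf_iff hf hG hinj).mp (h.trans ht)
  rwa [hp] at hs

theorem lift_map_top {k : Dim (n + 1 : ℕ)} (hk : k.1 = n + 1) {a b : D.cell (top n)}
    {p : Y.Term a b} {t : Free X} (ht : t ∈ p.lifts G f) :
    (genMap hf).lift.map k (.top hk t) = .top hk (Free.mk p) := by
  obtain ⟨k, _⟩ := k
  dsimp only at hk
  subst hk
  exact ((genMap hf).liftMap_top t rfl).trans (evalFree_of_mem_lifts hf p ht)

theorem mem_lifts_of_lift_map (hG : Hom.IsConvex G) (hinj : Function.Injective f)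
    {k : Dim (n + 1 : ℕ)} {hk : k.1 = n + 1} {a b : D.cell (top n)} {p : Y.Term a b} {t : Free X}
    (e : (genMap hf).lift.map k (.top hk t) = .top hk (Free.mk p)) : t ∈ p.lifts G f := by
  obtain ⟨k, _⟩ := k
  dsimp only at hk
  subst hk
  exact (evalFree_eq_cellOf_iff hf hG hinj).mp (((genMap hf).liftMap_top t rfl).symm.trans e)

/-- For top cells, the preimages of a class are the lifts of any formal cell representing it.
Choosing a formal composite as representative, a preimage comes with lifts of both factors by the
definition of `Term.lifts`. -/
theorem exists_factors (hG : Hom.IsConvex G) (hinj : Function.Injective f)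
    {i m k l : Dim (n + 1 : ℕ)} (u : Y.freeExt.cell k) (v : Y.freeExt.cell l) (h)
    (w : X.freeExt.cell m) (e : (genMap hf).lift.map m w = Y.freeExt.comp i m u v h) :
    (∃ u', (genMap hf).lift.map k u' = u) ∧ ∃ v', (genMap hf).lift.map l v' = v := by
  have hm := h.hm
  rcases u with ⟨hk, u⟩ | ⟨hk, u⟩ <;> rcases v with ⟨hl, v⟩ | ⟨hl, v⟩ <;>
    -- The dimension of a composite is the larger of those of its factors, so `w` is a top cell
    -- exactly when one of `u`, `v` is.
    rcases w with ⟨hw, w⟩ | ⟨hw, w⟩ <;> try omega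
  · obtain ⟨u', v', -, rfl, rfl, -⟩ := hG.exists_comp (ExtCell.old.inj e)
    exact ⟨⟨.old hk u', rfl⟩, ⟨.old hl v', rfl⟩⟩
  · induction v using Free.ind with | @h a b q => ?_
    obtain ⟨u', t, -, rfl, ht, -⟩ := mem_lifts_of_lift_map hf hG hinj
      (e.trans (congrArg (ExtCell.top hw) (Free.lw_mk u q (Layer.comp_old_top h))))
    exact ⟨⟨.old hk u', rfl⟩, ⟨.top hl t, lift_map_top hf hl ht⟩⟩
  · induction u using Free.ind with | @h a b q => ?_
    obtain ⟨v', t, -, rfl, ht, -⟩ := mem_lifts_of_lift_map hf hG hinj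
      (e.trans (congrArg (ExtCell.top hw) (Free.rw_mk v q (Layer.comp_top_old h))))
    exact ⟨⟨.top hk t, lift_map_top hf hk ht⟩, ⟨.old hl v', rfl⟩⟩
  · induction u using Free.ind with | @h a b p => ?_
    induction v using Free.ind with | @h a' b' q => ?_
    obtain ⟨t, r, -, ht, hr, -⟩ := mem_lifts_of_lift_map hf hG hinj
      (e.trans (congrArg (ExtCell.top hw) (Free.comp_mk p q (Layer.comp_top_top h))))
    exact ⟨⟨.top hk t, lift_map_top hf hk ht⟩,
      ⟨.top hl r, lift_map_top hf hl hr⟩⟩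

/-- This is the inductive step. In dimensions at most `n` the induced prefunctor is `G`, and in
dimension `n + 1` it is governed by lifts. -/
theorem isConvex_lift (hG : Hom.IsConvex G) (hinj : Function.Injective f) :
    Hom.IsConvex (genMap hf).lift where
  inj k x y h := by
    rcases x with ⟨hx, x⟩ | ⟨hx, x⟩ <;> rcases y with ⟨hy, y⟩ | ⟨hy, y⟩ <;> try omega
    · exact congrArg _ (hG.inj _ (ExtCell.old.inj h))
    · obtain ⟨k, _⟩ := k
      dsimp only at hx
      subst hx
      exact congrArg _ (evalFree_injective hf hG hinj
        (((genMap hf).liftMap_top x rfl).symm.trans (h.trans ((genMap hf).liftMap_top y rfl))))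
  left u v h w e := (exists_factors hf hG hinj u v h w e).1
  right u v h w e := (exists_factors hf hG hinj u v h w e).2

/-! ### Counting occurrences of generators -/

open Classical in
/-- The number of occurrences of a generator in a formal cell. -/
noncomputable def Term.count (x : X.gen) : ∀ {a b : C.cell (top n)}, X.Term a b → ℕ
  | _, _, .gen g => if g = x then 1 else 0
  | _, _, .idn _ => 0
  | _, _, .comp _ p q => p.count x + q.count x
  | _, _, .lw _ _ _ p => p.count x
  | _, _, .rw _ _ _ p => p.count x

/-- No axiom duplicates or discards an `(n+1)`-generator: distributivity repeats only whiskering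
cells, which have dimension at most `n` and are not counted. -/
theorem Rel.count_eq (x : X.gen) {a b a' b' : C.cell (top n)} {p : X.Term a b}
    {q : X.Term a' b'} (h : Rel p q) : p.count x = q.count x := by
  induction h <;> simp_all [Term.count, add_assoc]

theorem genCell_injective : Function.Injective X.genCell := by
  intro x y h
  have := (cellOf_eq_iff.mp h).count_eq y
  by_contra hxy
  simp [Term.count, hxy] at this

end Gens

end Precat

/-! ### Faithfulness and monomorphisms for cellular extensions -/

namespace Precat

namespace CellExt

variable {n : ℕ} {A : Type (u + 1)} [Category.{u} A] (F : A ⥤ Precat.{u} n)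

theorem isConvex_free {P Q : CellExt F} {f : P ⟶ Q} (h : Precat.Hom.IsConvex (F.map f.base))
    (hf : Function.Injective f.gen) : Precat.Hom.IsConvex ((free F).map f) :=
  Gens.isConvex_lift (fun ε x => f.bd_gen ε x) h hf

/-- A morphism can be recovered from its induced prefunctor, because `C` embeds in `C[X]` and
distinct generators remain distinct there. -/
theorem faithful_free [F.Faithful] : (free F).Faithful where
  map_injective {P Q} f g h := by
    have h' : (genMap F f).lift = (genMap F g).lift := h
    refine Hom.ext (F.map_injective ?_) (funext fun x => Gens.genCell_injective ?_)
    · ext k x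
      have e := congrArg (fun H : P.gens.freeExt ⟶ Q.gens.freeExt =>
        H.map (up (le_succ' n) k) (rmap P.gens.incl k x)) h'
      exact ExtCell.old.inj e
    · have e := congrArg (fun H : P.gens.freeExt ⟶ Q.gens.freeExt =>
        H.map (top (n + 1)) (P.gens.genCell x)) h'
      exact ((genMap F f).lift_gen x).symm.trans (e.trans ((genMap F g).lift_gen x))

/-- The functor which adjoins no generators. -/
def addNone : A ⥤ CellExt F where
  obj P :=
    { base := P
      gens := { gen := PEmpty, bd := fun _ => PEmpty.elim, par := fun _ _ _ => PEmpty.rec } }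
  map f := { base := f, gen := id, bd_gen := fun _ => PEmpty.rec }

/-- Adjoining no generators is left adjoint to forgetting the generators. -/
def addNoneAdj : addNone F ⊣ forget F :=
  Adjunction.mkOfHomEquiv
    { homEquiv := fun _ _ =>
        { toFun := fun f => f.base
          invFun := fun f => { base := f, gen := PEmpty.elim, bd_gen := fun _ => PEmpty.rec }
          left_inv := fun _ => Hom.ext rfl (funext (PEmpty.rec))
          right_inv := fun _ => rfl }
      homEquiv_naturality_left_symm := fun _ _ => Hom.ext rfl (funext (PEmpty.rec))
      homEquiv_naturality_right := fun _ _ => rfl }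

variable {F}

/-- Forgetting the top generators is a right adjoint, hence preserves monomorphisms. -/
theorem mono_base {P Q : CellExt F} (f : P ⟶ Q) (_ : Mono f) : Mono f.base :=
  have := (addNoneAdj F).isRightAdjoint
  inferInstanceAs (Mono ((forget F).map f))

/-- Two generators with the same image under `f` have boundaries with the same image, hence equal
boundaries by `hf`. They are thus two possible values for one generator with that boundary, and `f`
cannot tell these choices apart. -/
theorem gen_injective_of_mono {P Q : CellExt F} (f : P ⟶ Q) (_ : Mono f)
    (hf : Function.Injective ((F.map f.base).map (top n))) : Function.Injective f.gen := by
  intro x y h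
  have hb : ∀ ε, P.gens.bd ε x = P.gens.bd ε y := fun ε => hf (by
    rw [← f.bd_gen, ← f.bd_gen, h])
  -- The test object: the base of `P` with a single generator, whose boundary is the common boundary
  -- of `x` and `y`.
  let R : CellExt F := ⟨P.base, PUnit, fun ε _ => P.gens.bd ε x, fun ε j h _ => P.gens.par ε j h x⟩
  have hid : ∀ z : (F.obj P.base).cell (top n), (F.map (𝟙 P.base)).map (top n) z = z := fun z => by
    rw [F.map_id]; rfl
  let a : R ⟶ P := { base := 𝟙 _, gen := fun _ => x, bd_gen := fun ε _ => (hid _).symm }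
  let b : R ⟶ P := { base := 𝟙 _, gen := fun _ => y, bd_gen := fun ε _ =>
    (hb ε).symm.trans (hid _).symm }
  have e : a = b := (cancel_mono f).mp (Hom.ext rfl (funext fun _ => h))
  exact congrArg (fun c : R ⟶ P => c.gen PUnit.unit) e

end CellExt

theorem faithful_disc : disc.{u}.Faithful where
  map_injective {X Y} F G h := by
    ext x
    exact congrArg (fun H : disc.obj X ⟶ disc.obj Y => H.map (top 0) x) h

/-- Only this implication is required: the way back from a monomorphism of precategories goes
through faithfulness and never through injectivity on cells. -/
theorem mono_of_injective {m : ℕ∞} {C D : Precat.{u} m} (G : C ⟶ D)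
    (h : ∀ k, Function.Injective (G.map k)) : Mono G where
  right_cancellation a b e := by
    ext k x
    exact h k (congrArg (fun H => (Hom.toHom H).map k x) e)

end Precat

/-! ### The equivalence for finite dimensions -/

namespace Pol

/-- Injectivity on generators. -/
def GenInj {n : ℕ} {P Q : Pol.{u} n} (F : P ⟶ Q) : Prop :=
  ∀ (k : ℕ) (hk : k ≤ n), Function.Injective ((Pol.gen n k hk).map F)

theorem gen_of_le {n k : ℕ} (h : k ≤ n + 1) (hk : k ≤ n) :
    gen.{u} (n + 1) k h = trunc n ⋙ gen n k hk := by
  simp [gen, hk]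

theorem gen_top {n : ℕ} (h : n + 1 ≤ n + 1) :
    gen.{u} (n + 1) (n + 1) h = Precat.CellExt.topGen (polData.{u} n).free := by
  simp [gen]
  rfl

theorem genInj_succ {n : ℕ} {P Q : Pol.{u} (n + 1)} (F : P ⟶ Q) :
    GenInj F ↔ GenInj ((Pol.trunc n).map F) ∧
      Function.Injective (Precat.CellExt.Hom.gen (F := (polData.{u} n).free) F) := by
  constructor
  · refine fun h => ⟨fun k hk => ?_, ?_⟩
    · have := h k (by omega)
      rw [gen_of_le _ hk] at this
      exact this
    · have := h (n + 1) le_rfl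
      rw [gen_top] at this
      exact this
  · rintro ⟨h, h'⟩ k hk
    rcases hk.lt_or_eq with hk' | rfl
    · rw [gen_of_le _ (Nat.le_of_lt_succ hk')]
      exact h k _
    · rw [gen_top]
      exact h'

/-- Injectivity on cells alone would not be inductive. Closure under factors in dimension `n` is
what makes the `(n+1)`-cells embed. -/
theorem isConvex_free (n : ℕ) : ∀ {P Q : Pol.{u} n} (F : P ⟶ Q), GenInj F →
    Precat.Hom.IsConvex ((Pol.free n).map F) := by
  induction n with
  | zero =>
    intro P Q F h
    have h0 := h 0 le_rfl
    refine ⟨fun k => h0, fun {i m k l} u v c => ?_, fun {i m k l} u v c => ?_⟩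
    -- There are no composites of `0`-cells: `i + 1 = min k l` is impossible with `k ≤ 0`.
    all_goals
      have := c.hi
      have := Precat.Dim.le k
      omega
  | succ n ih =>
    intro P Q F h
    rw [genInj_succ] at h
    exact Precat.CellExt.isConvex_free (polData.{u} n).free (ih _ h.1) h.2

instance faithful_free (n : ℕ) : (Pol.free.{u} n).Faithful := by
  induction n with
  | zero =>
    exact Precat.faithful_disc
  | succ n ih =>
    have : (polData.{u} n).free.Faithful := ih
    exact Precat.CellExt.faithful_free (polData.{u} n).free

/-- The truncation of `F` is again a monomorphism, so the induction gives injectivity on lower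
generators. Convexity turns this into injectivity on `n`-cells, which is exactly what separating the
top generators requires. -/
theorem genInj_of_mono (n : ℕ) : ∀ {P Q : Pol.{u} n} (F : P ⟶ Q), Mono F → GenInj F := by
  induction n with
  | zero =>
    intro P Q F h k hk
    exact (mono_iff_injective (X := (P : Type u)) (Y := (Q : Type u)) F).mp h
  | succ n ih =>
    intro P Q F h
    have hb : GenInj ((Pol.trunc n).map F) :=
      ih _ (Precat.CellExt.mono_base (F := (polData.{u} n).free) F h)
    exact (genInj_succ F).mpr ⟨hb, Precat.CellExt.gen_injective_of_mono
      (F := (polData.{u} n).free) F h ((isConvex_free n _ hb).inj _)⟩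

theorem tfae_mono (n : ℕ) {P Q : Pol.{u} n} (F : P ⟶ Q) :
    List.TFAE [Mono F, GenInj F, Mono ((Pol.free n).map F)] := by
  tfae_have 1 → 2 := genInj_of_mono n F
  tfae_have 2 → 3 := fun h => Precat.mono_of_injective _ (isConvex_free n F h).inj
  tfae_have 3 → 1 := fun h => (Pol.free n).mono_of_mono_map h
  tfae_finish

end Pol

/-! ### Doubling the generators of a cellular extension -/

namespace Precat.CellExt

variable {n : ℕ} {A : Type (u + 1)} [Category.{u} A] {F : A ⥤ Precat.{u} n}

/-- Boundaries in the double are transported from `P` along a section `d`; by this identity each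
projection with `d` as section returns them unchanged. -/
theorem map_map_of_comp_eq_id {P Q : A} {f : P ⟶ Q} {g : Q ⟶ P} (h : f ≫ g = 𝟙 P) (k : Dim n)
    (x : (F.obj P).cell k) : (F.map g).map k ((F.map f).map k x) = x := by
  rw [← comp_map, ← F.map_comp, h, F.map_id, id_map]

/-- The cellular extension over `A₀` whose generators are the pairs of parallel generators of `P`
which are identified by `f`. -/
def double {P Q : CellExt F} (f : P ⟶ Q) {A₀ : A} (d : P.base ⟶ A₀) : CellExt F where
  base := A₀
  gens :=
    { gen := {p : P.gens.gen × P.gens.gen //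
        f.gen p.1 = f.gen p.2 ∧ ∀ ε, P.gens.bd ε p.1 = P.gens.bd ε p.2}
      -- The two members of a pair have the same boundary, so that of the first can be used for both
      -- projections.
      bd := fun ε p => (F.map d).map (top n) (P.gens.bd ε p.1.1)
      par := fun ε j h p => by rw [← (F.map d).map_bd, ← (F.map d).map_bd, P.gens.par ε j h] }

section

variable {P Q : CellExt F} (f : P ⟶ Q) {A₀ : A} (d : P.base ⟶ A₀) {a b : A₀ ⟶ P.base}

/-- The first projection of a double. -/
def doubleFst (h : d ≫ a = 𝟙 _) : double f d ⟶ P :=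
  Hom.mk (P := double f d) a (fun p => p.1.1) fun _ _ => (map_map_of_comp_eq_id h _ _).symm

/-- The second projection of a double. -/
def doubleSnd (h : d ≫ b = 𝟙 _) : double f d ⟶ P :=
  Hom.mk (P := double f d) b (fun p => p.1.2)
    fun ε p => (p.2.2 ε).symm.trans (map_map_of_comp_eq_id h _ _).symm

/-- The diagonal of a double. -/
def doubleDiag : P ⟶ double f d :=
  Hom.mk (Q := double f d) d (fun p => ⟨(p, p), rfl, fun _ => rfl⟩) fun _ _ => rfl

theorem doubleDiag_fst (h : d ≫ a = 𝟙 _) : doubleDiag f d ≫ doubleFst f d h = 𝟙 P :=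
  Hom.ext h rfl

theorem doubleDiag_snd (h : d ≫ b = 𝟙 _) : doubleDiag f d ≫ doubleSnd f d h = 𝟙 P :=
  Hom.ext h rfl

theorem double_condition (ha : d ≫ a = 𝟙 _) (hb : d ≫ b = 𝟙 _) (h : a ≫ f.base = b ≫ f.base) :
    doubleFst f d ha ≫ f = doubleSnd f d hb ≫ f :=
  Hom.ext h (funext fun p => p.2.1)

/-- By `hf`, generators with the same image are parallel, so they form a generator of the double.
Equality of the two projections at it says that they coincide. -/
theorem gen_injective_of_double (ha : d ≫ a = 𝟙 _) (hb : d ≫ b = 𝟙 _)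
    (h : doubleFst f d ha = doubleSnd f d hb)
    (hf : Function.Injective ((F.map f.base).map (top n))) : Function.Injective f.gen := by
  intro x y e
  have e' : ∀ ε, P.gens.bd ε x = P.gens.bd ε y := fun ε => hf (by
    rw [← f.bd_gen, ← f.bd_gen, e])
  exact congrArg (fun c : double f d ⟶ P => c.gen ⟨(x, y), e, e'⟩) h

end

end Precat.CellExt

theorem Pol.GenInj.comp {n : ℕ} {P Q R : Pol.{u} n} {F : P ⟶ Q} {G : Q ⟶ R} (hF : GenInj F)
    (hG : GenInj G) : GenInj (F ≫ G) := by
  intro k hk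
  rw [Functor.map_comp]
  exact (hG k hk).comp (hF k hk)

/-! ### The equivalence for `ω`-polygraphs -/

namespace OmegaPol

variable {P Q : OmegaPol.{u}} (F : P ⟶ Q)

theorem trunc_map_eq (n : ℕ) : (Pol.trunc n).map (F.map (n + 1)) =
    eqToHom (P.trunc_obj n) ≫ F.map n ≫ eqToHom (Q.trunc_obj n).symm := by
  rw [← Category.assoc, ← F.trunc_map]
  simp

/-- The truncation of `F.map (n + 1)` differs from `F.map n` only by isomorphisms, which are
injective on generators because they are monomorphisms. -/
theorem genInj_trunc_map {n : ℕ} (h : Pol.GenInj (F.map n)) :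
    Pol.GenInj ((Pol.trunc n).map (F.map (n + 1))) := by
  rw [trunc_map_eq]
  exact (Pol.genInj_of_mono n _ inferInstance).comp (h.comp (Pol.genInj_of_mono n _ inferInstance))

theorem genInj_map (h : ∀ k, Function.Injective ((gen k).map F)) (n : ℕ) :
    Pol.GenInj (F.map n) := by
  induction n with
  | zero =>
    intro k hk
    obtain rfl : k = 0 := by omega
    exact h 0
  | succ n ih =>
    refine (Pol.genInj_succ _).mpr ⟨genInj_trunc_map F ih, ?_⟩
    have := h (n + 1)
    rw [gen, Pol.gen_top] at this
    exact this

/-- An `n`-polygraph with a split pair of morphisms to the `n`-truncation of `P` which are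
identified by `F`. -/
structure SplitPair (n : ℕ) where
  obj : Pol.{u} n
  fst : obj ⟶ P.obj n
  snd : obj ⟶ P.obj n
  -- The common section carries boundaries of generators of `P` into `obj`, so that generators can
  -- be added in the next dimension.
  diag : P.obj n ⟶ obj
  diag_fst : diag ≫ fst = 𝟙 _
  diag_snd : diag ≫ snd = 𝟙 _
  condition : fst ≫ F.map n = snd ≫ F.map n

/-- The kernel pair of a map of sets. -/
def SplitPair.zero : SplitPair F 0 :=
  let f : (show Type u from P.obj 0) ⟶ (show Type u from Q.obj 0) := F.map 0
  { obj := show Type u from {p : (show Type u from P.obj 0) × (show Type u from P.obj 0) //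
      f p.1 = f p.2}
    fst := TypeCat.ofHom fun p => p.1.1
    snd := TypeCat.ofHom fun p => p.1.2
    diag := TypeCat.ofHom fun p => ⟨(p, p), rfl⟩
    diag_fst := rfl
    diag_snd := rfl
    condition := ConcreteCategory.hom_ext (C := Type u) _ _ fun p => p.2 }

namespace SplitPair

variable {F} {n : ℕ} (S : SplitPair F n)

theorem succ_diag_fst : (eqToHom (P.trunc_obj n) ≫ S.diag) ≫
    S.fst ≫ eqToHom (P.trunc_obj n).symm = 𝟙 _ := by
  simp [reassoc_of% S.diag_fst]

theorem succ_diag_snd : (eqToHom (P.trunc_obj n) ≫ S.diag) ≫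
    S.snd ≫ eqToHom (P.trunc_obj n).symm = 𝟙 _ := by
  simp [reassoc_of% S.diag_snd]

/-- The extension of a split pair by pairs of parallel generators. -/
noncomputable def succ : SplitPair F (n + 1) :=
  let f : (show Precat.CellExt (polData.{u} n).free from P.obj (n + 1)) ⟶ Q.obj (n + 1) :=
    F.map (n + 1)
  -- The truncation of `P.obj (n + 1)` is only propositionally equal to `P.obj n`, hence the
  -- transport before the section.
  let d : (Pol.trunc n).obj (P.obj (n + 1)) ⟶ S.obj := eqToHom (P.trunc_obj n) ≫ S.diag
  { obj := Precat.CellExt.double f d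
    fst := Precat.CellExt.doubleFst f d S.succ_diag_fst
    snd := Precat.CellExt.doubleSnd f d S.succ_diag_snd
    diag := Precat.CellExt.doubleDiag f d
    diag_fst := Precat.CellExt.doubleDiag_fst f d S.succ_diag_fst
    diag_snd := Precat.CellExt.doubleDiag_snd f d S.succ_diag_snd
    condition := Precat.CellExt.double_condition f d S.succ_diag_fst S.succ_diag_snd (by
      change (S.fst ≫ _) ≫ (Pol.trunc n).map (F.map (n + 1)) =
        (S.snd ≫ _) ≫ (Pol.trunc n).map (F.map (n + 1))
      rw [trunc_map_eq]
      simp [reassoc_of% S.condition]) }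

end SplitPair

/-- The split pairs obtained by doubling generators. -/
noncomputable def splitPair : ∀ n : ℕ, SplitPair F n
  | 0 => .zero F
  | n + 1 => (splitPair n).succ

/-- The `ω`-polygraph obtained by doubling generators. -/
noncomputable def double : OmegaPol.{u} where
  obj n := (splitPair F n).obj
  -- Each stage is built as a cellular extension with the previous stage as its base, so the
  -- truncation condition holds by definition.
  trunc_obj _ := rfl

/-- The first projection of the double. -/
noncomputable def doubleFst : double F ⟶ P where
  map n := (splitPair F n).fst
  trunc_map n := by
    -- The truncation of the next projection is by construction this projection followed by the
    -- transport that the compatibility condition undoes.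
    change ((splitPair F n).fst ≫ eqToHom (P.trunc_obj n).symm) ≫ eqToHom _ = 𝟙 _ ≫ _
    simp

/-- The second projection of the double. -/
noncomputable def doubleSnd : double F ⟶ P where
  map n := (splitPair F n).snd
  trunc_map n := by
    change ((splitPair F n).snd ≫ eqToHom (P.trunc_obj n).symm) ≫ eqToHom _ = 𝟙 _ ≫ _
    simp

theorem double_condition : doubleFst F ≫ F = doubleSnd F ≫ F :=
  Hom.ext (funext fun n => (splitPair F n).condition)

/-- Cancelling `F` makes the two projections of the double equal in every dimension at once.
Injectivity then goes up by induction, convexity supplying at each stage the injectivity on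
`n`-cells that shows identified generators to be parallel. -/
theorem genInj_of_mono (h : Mono F) (n : ℕ) : Pol.GenInj (F.map n) := by
  have e : ∀ n, (splitPair F n).fst = (splitPair F n).snd := fun n =>
    congrArg (fun G : double F ⟶ P => G.map n) ((cancel_mono F).mp (double_condition F))
  induction n with
  | zero =>
    intro k hk x y hxy
    -- In dimension `0` there is no boundary condition: the pair `(x, y)` belongs to the kernel pair
    -- by `hxy` alone.
    exact congrArg (fun G : (show Type u from (splitPair F 0).obj) ⟶ (show Type u from P.obj 0) =>
      G ⟨(x, y), hxy⟩) (e 0)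
  | succ n ih =>
    have hb := genInj_trunc_map F ih
    exact (Pol.genInj_succ _).mpr ⟨hb, Precat.CellExt.gen_injective_of_double
      (F := (polData.{u} n).free) _ _ (splitPair F n).succ_diag_fst (splitPair F n).succ_diag_snd
      (e (n + 1)) ((Pol.isConvex_free n _ hb).inj _)⟩

instance faithful_free : free.{u}.Faithful where
  map_injective {P Q} F G h := by
    refine Hom.ext (funext fun n => (Pol.free n).map_injective ?_)
    ext k x
    have hk := Precat.Dim.le k
    let k' : Dim ⊤ := ⟨k.1, le_top⟩
    -- Every `k`-cell of the stage `n` comes from a cell of the limit, so the prefunctor between the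
    -- limits determines those between all stages.
    obtain ⟨y, rfl⟩ := (P.tower.e n k' hk).surjective x
    have e := congrArg (fun H : free.obj P ⟶ free.obj Q => H.map k' y) h
    exact (Precat.Tower.Hom.e_map _ n k' hk y).symm.trans
      ((congrArg (Q.tower.e n k' hk) e).trans (Precat.Tower.Hom.e_map _ n k' hk y))

/-- The `k`-cells of the limit are the top cells of the stage `k`, where convexity gives
injectivity. -/
theorem mono_free_map (h : ∀ n, Pol.GenInj (F.map n)) : Mono (free.map F) :=
  Precat.mono_of_injective _ fun k => (Pol.isConvex_free k.1 _ (h k.1)).inj (Precat.top k.1)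

theorem tfae_mono : List.TFAE
    [Mono F, ∀ k, Function.Injective ((gen k).map F), Mono (free.map F)] := by
  tfae_have 1 → 2 := fun h k => genInj_of_mono F h k k le_rfl
  tfae_have 2 → 3 := fun h => mono_free_map F (genInj_map F h)
  tfae_have 3 → 1 := fun h => free.mono_of_mono_map h
  tfae_finish

end OmegaPol

/-- Monomorphisms of `n`-polygraphs, for `n ∈ ℕ` (first part) and for `n = ω` (second part). -/
theorem mainTheorem10 :
    (∀ (n : ℕ) (P Q : Pol.{u} n) (F : P ⟶ Q),
      List.TFAE [
        Mono F,
        ∀ (k : ℕ) (hk : k ≤ n), Function.Injective ((Pol.gen n k hk).map F),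
        Mono ((Pol.free n).map F)]) ∧
    (∀ (P Q : OmegaPol.{u}) (F : P ⟶ Q),
      List.TFAE [
        Mono F,
        ∀ k : ℕ, Function.Injective ((OmegaPol.gen k).map F),
        Mono (OmegaPol.free.map F)]) :=
  ⟨fun n _ _ F => Pol.tfae_mono n F, fun _ _ F => OmegaPol.tfae_mono F⟩
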